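/- Let $G=(V,E)$ be a finite simple graph. For $\lambda>0$ let $\mathbb P=\mathbb P_{G,\lambda}$ be the arboreal gas measure on $G$: the probability measure on the spanning forests $F$ of $G$ (acyclic subgraphs on the whole vertex set $V$) with $\mathbb P(F)\propto\lambda^{|E(F)|}$. For $a,b,c\in V$ write $\mathbb P(abc)$ for the probability that $a,b,c$ lie in one component of $F$, $\mathbb P(ab,c)$ for the probability that $a$ and $b$ lie in one component and $c$ in another (similarly $\mathbb P(a,bc)$ and $\mathbb P(ac,b)$), and $\mathbb P(a,b,c)$ for the probability that $a,b,c$ lie in three different components; no restriction is placed on the total number of components. Let $e_2(x,y,z)=xy+xz+yz$. Then, for all $a,b,c\in V$ and all sufficiently large $\lambda$, $$\bigl(\mathbb P(a,bc)+\mathbb P(ac,b)\bigr)\bigl(\mathbb P(ab,c)+\mathbb P(ac,b)\bigr)\;\le\;\mathbb P(a,b,c)\,\mathbb P(abc)+\mathbb P(ac,b)^2 .$$ Equivalently (for each $\lambda>0$ this inequality holds if and only if the preceding one does), for all sufficiently large $\lambda$, $$e_2\bigl(\mathbb P(a,bc),\,\mathbb P(ab,c),\,\mathbb P(ac,b)\bigr)\;\le\;\mathbb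 P(a,b,c)\,\mathbb P(abc).$$ Moreover, in each of the two inequalities equality holds to leading order in the limit: the two sides are asymptotically equivalent as $\lambda\to\infty$, i.e. their difference is $o$ of the right-hand side. -/

import Mathlib

namespace ArborealGas

open scoped Classical in
/-- The spanning forests of a finite graph `G`: the acyclic subgraphs of `G` on the whole vertex
set `V`, each identified with its edge set. -/
noncomputable def forests {V : Type*} [Fintype V] (G : SimpleGraph V) :
    Finset (SimpleGraph V) :=
  Finset.univ.filter fun F => F ≤ G ∧ F.IsAcyclic

/-- The weight `λ ^ |E(F)|` of a forest `F`. -/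
noncomputable def weight {V : Type*} (lam : ℝ) (F : SimpleGraph V) : ℝ :=
  lam ^ F.edgeSet.ncard

/-- The partition function: the total weight of all forests of `G`. -/
noncomputable def partitionFunction {V : Type*} [Fintype V] (G : SimpleGraph V) (lam : ℝ) : ℝ :=
  ∑ F ∈ forests G, weight lam F

open scoped Classical in
/-- The probability of the event `A` under the arboreal gas measure on `G` with parameter `lam`,
which gives each forest `F` of `G` a probability proportional to `lam ^ |E(F)|`. -/
noncomputable def prob {V : Type*} [Fintype V] (G : SimpleGraph V) (lam : ℝ)
    (A : SimpleGraph V → Prop) : ℝ :=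
  (∑ F ∈ (forests G).filter A, weight lam F) / partitionFunction G lam

/-- `P(abc)`: the vertices `a`, `b`, `c` all lie in one component. -/
noncomputable def probTogether {V : Type*} [Fintype V] (G : SimpleGraph V) (lam : ℝ)
    (a b c : V) : ℝ :=
  prob G lam fun F => F.Reachable a b ∧ F.Reachable a c ∧ F.Reachable b c

/-- `P(ab, c)`: the vertices `a` and `b` lie in one component, and `c` lies in another. -/
noncomputable def probPairSplit {V : Type*} [Fintype V] (G : SimpleGraph V) (lam : ℝ)
    (a b c : V) : ℝ :=
  prob G lam fun F => F.Reachable a b ∧ ¬ F.Reachable a c ∧ ¬ F.Reachable b c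

/-- `P(a, b, c)`: the vertices `a`, `b`, `c` lie in three different components. -/
noncomputable def probSeparate {V : Type*} [Fintype V] (G : SimpleGraph V) (lam : ℝ)
    (a b c : V) : ℝ :=
  prob G lam fun F => ¬ F.Reachable a b ∧ ¬ F.Reachable a c ∧ ¬ F.Reachable b c

/-- The elementary symmetric polynomial of degree two in three variables. -/
def e2 (x y z : ℝ) : ℝ := x * y + x * z + y * z

end ArborealGas

/-!
Consider the total weights of three kinds of forests: `A` for those with `a`, `b`, `c` together,
`B_ab`, `B_ac`, `B_bc` for those with exactly one pair together, and `C` for those with all three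
separate. Both forms of the inequality say that the gap `C A - e₂(B_ab, B_ac, B_bc)` is nonnegative,
and the asymptotic statements follow once it is `o(C A)`. There are two cases.

*No component of `G - {a, b, c}` has neighbours of all three vertices* (or two of the vertices
coincide). Then the gap is zero for every value of the parameter. Indeed `G` is glued from three
graphs, each of which avoids one of `a`, `b`, `c`. Gluing at `a` and `b` a graph that avoids `c`
acts linearly on the weights and multiplies the gap by a square (`massGap_sup`). After two such
steps, one of the three vertices is isolated, and the gap of what remains is zero
(`massGap_eq_zero_of_not_touches`).

*Some component of `G - {a, b, c}` has neighbours of all three vertices.* Let `R` consist of `a`,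
`b`, `c` and one vertex of each further component of `G`. A forest in the event of `C` separates the
vertices of `R`; similarly for the other events with one of `a`, `b`, `c`, or two of them, removed
from `R`. The forests of maximal weight are those in which each component contains exactly one of
these roots, and the next ones have one further component, free of roots. So, up to a power of the
parameter `λ`, the gap is a polynomial in `λ⁻¹` whose first two coefficients are polynomials in
numbers of forests with no, or with one, free component. Since vertices minus edges is `1` for a
tree, the latter are expressed through numbers of rooted forests with one or two added roots
(`sum_hasFreeComponent`).

Numbers of rooted forests solve Dirichlet problems (`lap_rootedCountReach`): normalized, they are
the harmonic functions `h_a`, `h_b`, `h_c` of the roots and the Green function of the graph with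
boundary `R`. Adding roots changes these by rank one, and removing roots gives minors of the
response matrix. It follows that the constant coefficient of the gap is zero (`leading_identity`),
and that the next one is the square of the number of rooted forests times `rho = ∑ [a c] [b c]`
(`first_order_identity`), where the sum is over edges `uv` and `[i j] = h_i(u) h_j(v) - h_j(u)
h_i(v)`. Harmonicity turns `rho` into the sum over edges of `(h_c(u) - h_c(v)) ^ 2` times a
nonnegative combination of the products of a value of `h_a` and one of `h_b` (`rho_eq_sum_sq`). By
the minimum principle this is positive if some component touches `a`, `b` and `c` (`rho_pos`). Hence
the gap is eventually positive, and it is one order in `λ` smaller than `C A`.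
-/

namespace ArborealGas

open Finset SimpleGraph

/-! ### Adding and deleting an edge -/

section

variable {V : Type*}

lemma reachable_sup_edge_iff (F : SimpleGraph V) {u v : V} (x y : V) :
    (F ⊔ edge u v).Reachable x y ↔ F.Reachable x y ∨ (F.Reachable x u ∧ F.Reachable v y) ∨
      (F.Reachable x v ∧ F.Reachable u y) := by
  constructor
  · rintro ⟨p⟩
    induction p with
    | nil => exact Or.inl (Reachable.refl _)
    | @cons x w y h p ih =>
      rcases h with h | h
      · have hx := h.reachable
        rcases ih with ih | ⟨h1, h2⟩ | ⟨h1, h2⟩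
        · exact Or.inl (hx.trans ih)
        · exact Or.inr (Or.inl ⟨hx.trans h1, h2⟩)
        · exact Or.inr (Or.inr ⟨hx.trans h1, h2⟩)
      · rw [edge_adj] at h
        rcases h.1 with ⟨rfl, rfl⟩ | ⟨rfl, rfl⟩
        · rcases ih with ih | ⟨h1, h2⟩ | ⟨h1, h2⟩
          · exact Or.inr (Or.inl ⟨Reachable.refl _, ih⟩)
          · exact Or.inr (Or.inl ⟨Reachable.refl _, h2⟩)
          · exact Or.inl h2
        · rcases ih with ih | ⟨h1, h2⟩ | ⟨h1, h2⟩
          · exact Or.inr (Or.inr ⟨Reachable.refl _, ih⟩)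
          · exact Or.inl h2
          · exact Or.inr (Or.inr ⟨Reachable.refl _, h2⟩)
  · have huv : (F ⊔ edge u v).Reachable u v := by
      by_cases h : u = v
      · exact h ▸ Reachable.refl _
      · exact Adj.reachable (Or.inr (by rw [edge_adj]; exact ⟨Or.inl ⟨rfl, rfl⟩, h⟩))
    have hm : ∀ {x y}, F.Reachable x y → (F ⊔ edge u v).Reachable x y :=
      fun h => h.mono le_sup_left
    rintro (h | ⟨h1, h2⟩ | ⟨h1, h2⟩)
    · exact hm h
    · exact (hm h1).trans (huv.trans (hm h2))
    · exact (hm h1).trans (huv.symm.trans (hm h2))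

/-- Deleting an edge `uw` does not affect what is connected to a vertex `x` that does not reach
`u`. -/
lemma reachable_deleteEdges_of_not_reachable {H : SimpleGraph V} {x y u w : V}
    (h : H.Reachable x y) (hu : ¬ H.Reachable x u) :
    (H.deleteEdges {s(u, w)}).Reachable x y := by
  classical
  obtain ⟨p⟩ := h
  refine reachable_deleteEdges_iff_exists_walk.2 ⟨p, fun he => hu ?_⟩
  exact ⟨p.takeUntil u (p.fst_mem_support_of_mem_edges he)⟩

lemma deleteEdges_sup_edge {F : SimpleGraph V} {u v : V} (h : F.Adj u v) :
    F.deleteEdges {s(u, v)} ⊔ edge u v = F := by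
  ext x y
  simp only [sup_adj, deleteEdges_adj, Set.mem_singleton_iff, edge_adj, Sym2.eq_iff]
  constructor
  · rintro (h' | ⟨⟨rfl, rfl⟩ | ⟨rfl, rfl⟩, _⟩)
    · exact h'.1
    · exact h
    · exact h.symm
  · intro hxy
    by_cases hc : x = u ∧ y = v ∨ x = v ∧ y = u
    · exact Or.inr ⟨hc, hxy.ne⟩
    · exact Or.inl ⟨hxy, hc⟩

lemma sup_edge_deleteEdges {F : SimpleGraph V} {u v : V} (h : ¬ F.Adj u v) :
    (F ⊔ edge u v).deleteEdges {s(u, v)} = F := by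
  ext x y
  simp only [sup_adj, deleteEdges_adj, Set.mem_singleton_iff, edge_adj, Sym2.eq_iff]
  constructor
  · rintro ⟨h1 | h1, h2⟩
    · exact h1
    · exact absurd h1.1 h2
  · intro hxy
    refine ⟨Or.inl hxy, ?_⟩
    rintro (⟨rfl, rfl⟩ | ⟨rfl, rfl⟩)
    · exact h hxy
    · exact h hxy.symm

lemma sup_edge_adj {F : SimpleGraph V} {u v : V} (h : u ≠ v) : (F ⊔ edge u v).Adj u v :=
  Or.inr (by rw [edge_adj]; exact ⟨Or.inl ⟨rfl, rfl⟩, h⟩)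

/-! ### Rooted forests -/

/-- Every component of `F` contains exactly one vertex of `K`, the *root* of that component. -/
structure IsRooted (F : SimpleGraph V) (K : Finset V) : Prop where
  /-- Every vertex reaches a root. -/
  exists_root : ∀ v, ∃ k ∈ K, F.Reachable v k
  /-- Distinct roots lie in distinct components. -/
  eq_of_reachable : ∀ k ∈ K, ∀ l ∈ K, F.Reachable k l → k = l

section decidable
variable [DecidableEq V]

lemma IsRooted.sup_edge {F : SimpleGraph V} {K : Finset V} {u u' : V}
    (hF : IsRooted F (insert u K)) (hu : u ∉ K) (h : ¬ F.Reachable u u') :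
    IsRooted (F ⊔ edge u u') K := by
  obtain ⟨k', hk', hr'⟩ := hF.exists_root u'
  have hk'u : k' ≠ u := by rintro rfl; exact h hr'.symm
  have hk'K : k' ∈ K := (mem_insert.1 hk').resolve_left hk'u
  refine ⟨fun v => ?_, fun k hk l hl hkl => ?_⟩
  · obtain ⟨k, hk, hr⟩ := hF.exists_root v
    rcases mem_insert.1 hk with rfl | hk
    · exact ⟨k', hk'K, (reachable_sup_edge_iff F _ _).2 (Or.inr (Or.inl ⟨hr, hr'⟩))⟩
    · exact ⟨k, hk, hr.mono le_sup_left⟩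
  · rcases (reachable_sup_edge_iff F _ _).1 hkl with h1 | ⟨h1, h2⟩ | ⟨h1, h2⟩
    · exact hF.eq_of_reachable _ (mem_insert_of_mem hk) _ (mem_insert_of_mem hl) h1
    · have := hF.eq_of_reachable _ (mem_insert_of_mem hk) _ (mem_insert_self _ _) h1
      exact absurd (this ▸ hk) hu
    · have := hF.eq_of_reachable _ (mem_insert_self _ _) _ (mem_insert_of_mem hl) h2
      exact absurd (this ▸ hl) hu

/-- In a forest rooted at `K`, deleting the first edge of the path from a non-root `u` to its root
turns `u` into a root. -/
lemma IsRooted.exists_deleteEdges {F : SimpleGraph V} {K : Finset V} {u : V} (hF : IsRooted F K)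
    (ha : F.IsAcyclic) (hu : u ∉ K) :
    ∃ u', F.Adj u u' ∧ IsRooted (F.deleteEdges {s(u, u')}) (insert u K) ∧
      ¬ (F.deleteEdges {s(u, u')}).Reachable u u' := by
  obtain ⟨k, hk, hr⟩ := hF.exists_root u
  obtain ⟨p, hp⟩ := hr.exists_isPath
  cases p with
  | nil => exact absurd hk hu
  | @cons _ u' _ h q =>
    rw [Walk.cons_isPath_iff] at hp
    have hbr : ¬ (F.deleteEdges {s(u, u')}).Reachable u u' :=
      isBridge_iff.1 (isAcyclic_iff_forall_adj_isBridge.1 ha h)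
    have hk' : (F.deleteEdges {s(u, u')}).Reachable u' k :=
      reachable_deleteEdges_iff_exists_walk.2
        ⟨q, fun he => hp.2 (q.fst_mem_support_of_mem_edges he)⟩
    have hroot : ∀ l ∈ K, ¬ (F.deleteEdges {s(u, u')}).Reachable u l := by
      intro l hl hul
      have : l = k := hF.eq_of_reachable l hl k hk
        ((hul.symm.mono (deleteEdges_le _)).trans hr)
      subst this
      exact hbr (hul.trans hk'.symm)
    refine ⟨u', h, ⟨fun v => ?_, fun a ha' b hb' hab => ?_⟩, hbr⟩
    · obtain ⟨l, hl, hvl⟩ := hF.exists_root v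
      rw [← deleteEdges_sup_edge h, reachable_sup_edge_iff] at hvl
      rcases hvl with h1 | ⟨h1, h2⟩ | ⟨h1, h2⟩
      · exact ⟨l, mem_insert_of_mem hl, h1⟩
      · exact ⟨u, mem_insert_self _ _, h1⟩
      · exact ⟨k, mem_insert_of_mem hk, h1.trans hk'⟩
    · rcases mem_insert.1 ha' with rfl | ha2
      · rcases mem_insert.1 hb' with rfl | hb2
        · rfl
        · exact absurd hab (hroot _ hb2)
      · rcases mem_insert.1 hb' with rfl | hb2
        · exact absurd hab.symm (hroot _ ha2)
        · exact hF.eq_of_reachable _ ha2 _ hb2 (hab.mono (deleteEdges_le _))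

/-- A rooted forest determines the edge that was added at `u` to obtain it: the first edge of the
path from `u` to its root. -/
lemma IsRooted.sup_edge_injective {F F' : SimpleGraph V} {K : Finset V} {u v v' : V} (hu : u ∉ K)
    (hF : IsRooted F (insert u K)) (hF' : IsRooted F' (insert u K))
    (h : ¬ F.Reachable u v) (h' : ¬ F'.Reachable u v')
    (he : F ⊔ edge u v = F' ⊔ edge u v') : v = v' ∧ F = F' := by
  have hne : u ≠ v := by rintro rfl; exact h (Reachable.refl _)
  have key : v = v' := by
    by_contra hvv
    have hadj : F'.Adj u v := by
      have : (F' ⊔ edge u v').Adj u v := he ▸ sup_edge_adj hne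
      rcases this with h1 | h1
      · exact h1
      · rw [edge_adj] at h1
        rcases h1.1 with ⟨_, h2⟩ | ⟨_, h2⟩
        · exact absurd h2 hvv
        · exact absurd h2.symm hne
    obtain ⟨k, hk, hr⟩ := hF.exists_root v
    have hku : k ≠ u := by rintro rfl; exact h hr.symm
    have hr2 : (F.deleteEdges {s(u, v')}).Reachable v k :=
      reachable_deleteEdges_of_not_reachable hr (fun hh => h hh.symm)
    have hle : F.deleteEdges {s(u, v')} ≤ F' := by
      intro x y hxy
      rw [deleteEdges_adj] at hxy
      have h3 : (F' ⊔ edge u v').Adj x y := he ▸ (Or.inl hxy.1)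
      rcases h3 with h4 | h4
      · exact h4
      · rw [edge_adj] at h4
        exact absurd (by simpa [Sym2.eq_iff] using h4.1) hxy.2
    have := hF'.eq_of_reachable u (mem_insert_self _ _) k hk
      (hadj.reachable.trans (hr2.mono hle))
    exact hku this.symm
  subst key
  refine ⟨rfl, ?_⟩
  rw [← sup_edge_deleteEdges (F := F) (u := u) (v := v) (fun hh => h hh.reachable), he,
    sup_edge_deleteEdges (fun hh => h' hh.reachable)]

end decidable

section counting
variable [Fintype V]

lemma mem_forests {G F : SimpleGraph V} : F ∈ forests G ↔ F ≤ G ∧ F.IsAcyclic := by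
  simp [forests]

open scoped Classical in
/-- The spanning forests of `G` in which every component contains exactly one vertex of `K`. -/
noncomputable def rootedForests (G : SimpleGraph V) (K : Finset V) : Finset (SimpleGraph V) :=
  (forests G).filter fun F => IsRooted F K

lemma mem_rootedForests {G F : SimpleGraph V} {K : Finset V} :
    F ∈ rootedForests G K ↔ (F ≤ G ∧ F.IsAcyclic) ∧ IsRooted F K := by
  simp [rootedForests, mem_forests]

open scoped Classical in
/-- The forests rooted at `K` arise, each exactly once, from the forests rooted at `K ∪ {u}` by
adding an edge from `u` to another component. -/
theorem sum_rootedForests [DecidableEq V] (G : SimpleGraph V) {K : Finset V} {u : V} (hu : u ∉ K)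
    (φ : SimpleGraph V → ℝ) :
    ∑ F ∈ rootedForests G K, φ F = ∑ u', if G.Adj u u' then
      ∑ F ∈ rootedForests G (insert u K), if F.Reachable u u' then 0 else φ (F ⊔ edge u u')
      else 0 := by
  have h1 : (∑ u', if G.Adj u u' then
      ∑ F ∈ rootedForests G (insert u K), if F.Reachable u u' then 0 else φ (F ⊔ edge u u')
      else 0) = ∑ p ∈ ((univ : Finset V) ×ˢ rootedForests G (insert u K)).filter
        (fun p => G.Adj u p.1 ∧ ¬ p.2.Reachable u p.1), φ (p.2 ⊔ edge u p.1) := by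
    rw [sum_filter, sum_product]
    refine sum_congr rfl fun u' _ => ?_
    split_ifs with h
    · refine sum_congr rfl fun F _ => ?_
      by_cases hF : F.Reachable u u' <;> simp [h, hF]
    · simp [h]
  rw [h1]
  symm
  refine sum_nbij (fun p => p.2 ⊔ edge u p.1) ?_ ?_ ?_ (fun _ _ => rfl)
  · rintro ⟨u', F⟩ hp
    simp only [mem_filter, mem_product, mem_univ, true_and, mem_rootedForests] at hp ⊢
    obtain ⟨⟨⟨hle, hac⟩, hr⟩, hadj, hnr⟩ := hp
    refine ⟨⟨sup_le hle ?_, hac.sup_edge_of_not_reachable hnr⟩, hr.sup_edge hu hnr⟩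
    rw [edge_le_iff]; exact Or.inr hadj
  · rintro ⟨u', F⟩ hp ⟨u'', F'⟩ hp' he
    simp only [coe_filter, mem_product, mem_univ, true_and, mem_rootedForests,
      Set.mem_ofPred_eq] at hp hp'
    obtain ⟨h2, h3⟩ := IsRooted.sup_edge_injective hu hp.1.2 hp'.1.2 hp.2.2 hp'.2.2 he
    simp [h2, h3]
  · intro F hF
    simp only [mem_coe, mem_rootedForests] at hF
    obtain ⟨u', hadj, hr, hnr⟩ := hF.2.exists_deleteEdges hF.1.2 hu
    refine ⟨(u', F.deleteEdges {s(u, u')}), ?_, deleteEdges_sup_edge hadj⟩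
    simp only [coe_filter, mem_product, mem_univ, true_and, mem_rootedForests,
      Set.mem_ofPred_eq]
    exact ⟨⟨⟨(deleteEdges_le _).trans hF.1.1, hF.1.2.anti (deleteEdges_le _)⟩, hr⟩,
      hF.1.1 hadj, hnr⟩

open scoped Classical in
/-- The number of forests of `G` rooted at `K`. -/
noncomputable def rootedCount (G : SimpleGraph V) (K : Finset V) : ℝ :=
  ∑ _F ∈ rootedForests G K, 1

open scoped Classical in
/-- The number of forests of `G` rooted at `K` in which `x` and `s` are connected. -/
noncomputable def rootedCountReach (G : SimpleGraph V) (K : Finset V) (x s : V) : ℝ :=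
  ∑ F ∈ rootedForests G K, if F.Reachable x s then 1 else 0

open scoped Classical in
/-- By `sum_rootedForests`: after the edge `u u'` is added, `x` is connected to `s` if it was
before, or if it was connected to `u` and `u'` to `s`. -/
lemma rootedCountReach_of_not_mem [DecidableEq V] (G : SimpleGraph V) {K : Finset V} {u s : V}
    (hu : u ∉ K) (hs : s ∈ K) (x : V) :
    rootedCountReach G K x s = ∑ u', if G.Adj u u' then ∑ F ∈ rootedForests G (insert u K),
      ((if F.Reachable x s then if F.Reachable u' u then (0 : ℝ) else 1 else 0) +
        if F.Reachable x u then if F.Reachable u' s then 1 else 0 else 0) else 0 := by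
  rw [rootedCountReach, sum_rootedForests G hu]
  refine sum_congr rfl fun u' _ => ?_
  refine if_congr Iff.rfl (sum_congr rfl fun F hF => ?_) rfl
  have hr := (mem_rootedForests.1 hF).2
  have hus : ¬ F.Reachable u s := fun h => hu
    (hr.eq_of_reachable _ (mem_insert_self _ _) _ (mem_insert_of_mem hs) h ▸ hs)
  simp only [reachable_sup_edge_iff, reachable_comm (u := u') (v := u)]
  by_cases h1 : F.Reachable u u'
  · have h2 : ¬ F.Reachable u' s := fun h => hus (h1.trans h)
    simp [h1, h2]
  · by_cases h3 : F.Reachable x s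
    · have h4 : ¬ F.Reachable x u := fun h => hus (h.symm.trans h3)
      simp [h1, h3, h4]
    · simp [h1, h3, hus, ite_and]

lemma rootedCountReach_self_of_not_mem [DecidableEq V] (G : SimpleGraph V) {K : Finset V} {u s : V}
    (hu : u ∉ K) (hs : s ∈ K) : rootedCountReach G K u s =
      ∑ u', open scoped Classical in
        if G.Adj u u' then rootedCountReach G (insert u K) u' s else 0 := by
  classical
  rw [rootedCountReach_of_not_mem G hu hs]
  refine sum_congr rfl fun u' _ => ?_
  refine if_congr Iff.rfl (sum_congr rfl fun F hF => ?_) rfl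
  have hr := (mem_rootedForests.1 hF).2
  have hus : ¬ F.Reachable u s := fun h => hu
    (hr.eq_of_reachable _ (mem_insert_self _ _) _ (mem_insert_of_mem hs) h ▸ hs)
  simp [hus]

end counting
end

/-! ### Potential theory on a finite graph -/

section

variable {V : Type*}

/-- Every vertex of `G` is connected to `K`. -/
def Covers (G : SimpleGraph V) (K : Finset V) : Prop :=
  ∀ v, ∃ k ∈ K, G.Reachable v k

lemma Covers.mono {G : SimpleGraph V} {K L : Finset V} (h : Covers G K) (hKL : K ⊆ L) :
    Covers G L := fun v => let ⟨k, hk, hr⟩ := h v; ⟨k, hKL hk, hr⟩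

variable [Fintype V]

open scoped Classical in
/-- The graph Laplacian. -/
noncomputable def lap (G : SimpleGraph V) (f : V → ℝ) (u : V) : ℝ :=
  ∑ v, if G.Adj u v then f u - f v else 0

open scoped Classical in
lemma sum_mul_lap (G : SimpleGraph V) (f g : V → ℝ) :
    ∑ u, f u * lap G g u =
      (1 / 2) * ∑ u, ∑ v, if G.Adj u v then (f u - f v) * (g u - g v) else 0 := by
  have h1 : ∑ u, f u * lap G g u = ∑ u, ∑ v, if G.Adj u v then f u * (g u - g v) else 0 := by
    simp only [lap, mul_sum, mul_ite, mul_zero]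
  have h2 : ∑ u, f u * lap G g u = ∑ u, ∑ v, if G.Adj u v then -(f v * (g u - g v)) else 0 := by
    rw [h1, sum_comm]
    refine sum_congr rfl fun u _ => sum_congr rfl fun v _ => ?_
    simp only [G.adj_comm v u]
    split_ifs <;> ring
  have h3 : ∑ u, f u * lap G g u + ∑ u, f u * lap G g u =
      ∑ u, ∑ v, if G.Adj u v then (f u - f v) * (g u - g v) else 0 := by
    nth_rewrite 1 [h1]
    rw [h2, ← sum_add_distrib]
    refine sum_congr rfl fun u _ => ?_
    rw [← sum_add_distrib]
    refine sum_congr rfl fun v _ => ?_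
    split_ifs <;> ring
  linarith

lemma sum_mul_lap_comm (G : SimpleGraph V) (f g : V → ℝ) :
    ∑ u, f u * lap G g u = ∑ u, g u * lap G f u := by
  rw [sum_mul_lap, sum_mul_lap]
  simp only [mul_comm]

lemma lap_sub_mul (G : SimpleGraph V) (f g : V → ℝ) (c : ℝ) (u : V) :
    lap G (fun v => f v - c * g v) u = lap G f u - c * lap G g u := by
  classical
  simp only [lap, mul_sum]
  rw [← sum_sub_distrib]
  refine sum_congr rfl fun v _ => ?_
  split_ifs <;> ring

/-- Uniqueness in the Dirichlet problem with boundary `K`. -/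
theorem eq_zero_of_lap_eq_zero {G : SimpleGraph V} {K : Finset V} (hK : Covers G K) {f : V → ℝ}
    (h0 : ∀ k ∈ K, f k = 0) (hf : ∀ u, u ∉ K → lap G f u = 0) (v : V) : f v = 0 := by
  classical
  have h1 : ∑ u, f u * lap G f u = 0 := by
    refine sum_eq_zero fun u _ => ?_
    by_cases hu : u ∈ K
    · rw [h0 u hu, zero_mul]
    · rw [hf u hu, mul_zero]
  rw [sum_mul_lap] at h1
  have hnn : ∀ u v, 0 ≤ if G.Adj u v then (f u - f v) * (f u - f v) else 0 := by
    intro u v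
    split_ifs
    · exact mul_self_nonneg _
    · exact le_rfl
  have h2 : ∑ u, ∑ v, (if G.Adj u v then (f u - f v) * (f u - f v) else 0) = 0 := by linarith
  have h3 : ∀ u v, G.Adj u v → f u = f v := by
    intro u v huv
    have h4 := (sum_eq_zero_iff_of_nonneg (fun u _ => sum_nonneg fun v _ => hnn u v)).1 h2 u
      (mem_univ _)
    have h5 := (sum_eq_zero_iff_of_nonneg (fun v _ => hnn u v)).1 h4 v (mem_univ _)
    rw [if_pos huv] at h5
    exact sub_eq_zero.1 (mul_self_eq_zero.1 h5)
  obtain ⟨k, hk, ⟨p⟩⟩ := hK v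
  have : ∀ {x y} (p : G.Walk x y), f x = f y := by
    intro x y p
    induction p with
    | nil => rfl
    | cons h _ ih => exact (h3 _ _ h).trans ih
  rw [this p, h0 k hk]

/-! ### Counts of rooted forests as solutions of Dirichlet problems -/

/-- A rooted forest exists: a maximal forest among those whose components contain at most one
vertex of `K` has no rootless component. -/
lemma exists_rootedForest {G : SimpleGraph V} {K : Finset V} (hK : Covers G K) :
    (rootedForests G K).Nonempty := by
  classical
  let S : Finset (SimpleGraph V) := (forests G).filter fun F =>
    ∀ k ∈ K, ∀ l ∈ K, F.Reachable k l → k = l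
  have hS : S.Nonempty := by
    refine ⟨⊥, ?_⟩
    simp only [S, mem_filter, mem_forests]
    refine ⟨⟨bot_le, isAcyclic_bot⟩, fun k _ l _ h => ?_⟩
    simpa using h
  obtain ⟨F, hF, hmax⟩ := S.exists_maximal hS
  simp only [S, mem_filter, mem_forests] at hF
  refine ⟨F, mem_rootedForests.2 ⟨hF.1, ⟨fun v => ?_, hF.2⟩⟩⟩
  by_contra hv
  push Not at hv
  obtain ⟨k, hk, ⟨p⟩⟩ := hK v
  obtain ⟨d, -, hd1, hd2⟩ := p.exists_boundary_dart {x | F.Reachable v x} (Reachable.refl _)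
    (hv k hk)
  have hd1 : F.Reachable v d.fst := hd1
  have hd2 : ¬ F.Reachable v d.snd := hd2
  have hnr : ¬ F.Reachable d.fst d.snd := fun h => hd2 (hd1.trans h)
  have hmem : F ⊔ edge d.fst d.snd ∈ S := by
    simp only [S, mem_filter, mem_forests]
    refine ⟨⟨sup_le hF.1.1 ((edge_le_iff _).2 (Or.inr d.adj)),
      hF.1.2.sup_edge_of_not_reachable hnr⟩, fun k hk l hl hkl => ?_⟩
    rcases (reachable_sup_edge_iff F _ _).1 hkl with h | ⟨h, _⟩ | ⟨_, h⟩
    · exact hF.2 k hk l hl h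
    · exact absurd (hd1.trans h.symm) (hv k hk)
    · exact absurd (hd1.trans h) (hv l hl)
  have hle := hmax hmem le_sup_left
  exact hnr (hle (sup_edge_adj (by rintro h; exact hnr (h ▸ Reachable.refl _)))).reachable

lemma rootedCount_pos {G : SimpleGraph V} {K : Finset V} (hK : Covers G K) :
    0 < rootedCount G K :=
  sum_pos (fun _ _ => one_pos) (exists_rootedForest hK)

lemma rootedCountReach_nonneg (G : SimpleGraph V) (K : Finset V) (x s : V) :
    0 ≤ rootedCountReach G K x s :=
  sum_nonneg fun _ _ => by split_ifs <;> norm_num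

lemma rootedCountReach_self (G : SimpleGraph V) (K : Finset V) (s : V) :
    rootedCountReach G K s s = rootedCount G K := by
  simp [rootedCountReach, rootedCount]

lemma rootedCountReach_eq_zero (G : SimpleGraph V) {K : Finset V} {s t : V} (hs : s ∈ K)
    (ht : t ∈ K) (h : s ≠ t) : rootedCountReach G K s t = 0 := by
  refine sum_eq_zero fun F hF => if_neg fun hr => h ?_
  exact (mem_rootedForests.1 hF).2.eq_of_reachable s hs t ht hr

lemma rootedCountReach_eq_zero_of_not_reachable {G : SimpleGraph V} (K : Finset V) {x s : V}
    (h : ¬ G.Reachable x s) : rootedCountReach G K x s = 0 := by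
  refine sum_eq_zero fun F hF => if_neg fun hr => h ?_
  exact hr.mono (mem_rootedForests.1 hF).1.1

lemma sum_rootedCountReach (G : SimpleGraph V) (K : Finset V) (x : V) :
    ∑ s ∈ K, rootedCountReach G K x s = rootedCount G K := by
  classical
  simp only [rootedCountReach, rootedCount]
  rw [sum_comm]
  refine sum_congr rfl fun F hF => ?_
  have hr := (mem_rootedForests.1 hF).2
  obtain ⟨k, hk, hxk⟩ := hr.exists_root x
  rw [sum_eq_single_of_mem k hk, if_pos hxk]
  intro l hl hlk
  exact if_neg fun hxl => hlk (hr.eq_of_reachable l hl k hk (hxl.symm.trans hxk))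

/-- The numbers of rooted forests solve a Dirichlet problem: expressed through the forests rooted at
`K ∪ {u}` and pairs `v`, `u'` of neighbours of `u`, the Laplacian is a sum that is antisymmetric in
`v` and `u'`. -/
lemma lap_rootedCountReach [DecidableEq V] (G : SimpleGraph V) {K : Finset V} {u s : V}
    (hu : u ∉ K) (hs : s ∈ K) : lap G (fun v => rootedCountReach G K v s) u = 0 := by
  classical
  have e1 : ∀ v, rootedCountReach G K u s - rootedCountReach G K v s =
      ∑ F ∈ rootedForests G (insert u K), ∑ u', if G.Adj u u' then
        (if F.Reachable u' s then if F.Reachable v u then (0 : ℝ) else 1 else 0) -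
        (if F.Reachable v s then if F.Reachable u' u then (0 : ℝ) else 1 else 0) else 0 := by
    intro v
    rw [rootedCountReach_self_of_not_mem G hu hs, rootedCountReach_of_not_mem G hu hs,
      ← sum_sub_distrib, sum_comm]
    refine sum_congr rfl fun u' _ => ?_
    by_cases h : G.Adj u u'
    · simp only [h, if_true, rootedCountReach]
      rw [← sum_sub_distrib]
      refine sum_congr rfl fun F _ => ?_
      by_cases h1 : F.Reachable v u <;> by_cases h2 : F.Reachable u' s <;> simp [h1, h2]
    · simp [h]
  have e2 : lap G (fun v => rootedCountReach G K v s) u =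
      ∑ F ∈ rootedForests G (insert u K), ∑ v, ∑ u', if G.Adj u v then if G.Adj u u' then
        (if F.Reachable u' s then if F.Reachable v u then (0 : ℝ) else 1 else 0) -
        (if F.Reachable v s then if F.Reachable u' u then (0 : ℝ) else 1 else 0) else 0 else 0 := by
    rw [lap, sum_comm]
    refine sum_congr rfl fun v _ => ?_
    rw [e1]
    split_ifs
    · rfl
    · simp
  rw [e2]
  refine sum_eq_zero fun F _ => ?_
  set S := ∑ v, ∑ u', if G.Adj u v then if G.Adj u u' then
        (if F.Reachable u' s then if F.Reachable v u then (0 : ℝ) else 1 else 0) -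
        (if F.Reachable v s then if F.Reachable u' u then (0 : ℝ) else 1 else 0) else 0 else 0
    with hS
  have : S = -S := by
    nth_rewrite 1 [hS]
    rw [sum_comm, hS, ← sum_neg_distrib]
    refine sum_congr rfl fun v _ => ?_
    rw [← sum_neg_distrib]
    refine sum_congr rfl fun u' _ => ?_
    by_cases h1 : G.Adj u v <;> by_cases h2 : G.Adj u u' <;> simp [h1, h2]
  linarith

/-- The probability that `v` is connected to the root `s` in a uniform forest rooted at `K`. -/
noncomputable def harm (G : SimpleGraph V) (K : Finset V) (s v : V) : ℝ :=
  rootedCountReach G K v s / rootedCount G K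

/-- The Green function of the walk killed on `K`, for `u ∉ K`. -/
noncomputable def green [DecidableEq V] (G : SimpleGraph V) (K : Finset V) (u v : V) : ℝ :=
  rootedCountReach G (insert u K) v u / rootedCount G K

section
variable {G : SimpleGraph V} {K : Finset V}

lemma lap_div (f : V → ℝ) (c : ℝ) (u : V) : lap G (fun v => f v / c) u = lap G f u / c := by
  classical
  simp only [lap, sum_div]
  refine sum_congr rfl fun v _ => ?_
  split_ifs <;> ring

lemma harm_self (hK : Covers G K) (s : V) : harm G K s s = 1 := by
  rw [harm, rootedCountReach_self, div_self (rootedCount_pos hK).ne']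

lemma harm_of_ne {s t : V} (hs : s ∈ K) (ht : t ∈ K) (h : t ≠ s) : harm G K s t = 0 := by
  rw [harm, rootedCountReach_eq_zero G ht hs h, zero_div]

lemma harm_nonneg (s v : V) : 0 ≤ harm G K s v :=
  div_nonneg (rootedCountReach_nonneg _ _ _ _) (sum_nonneg fun _ _ => zero_le_one)

lemma harm_eq_zero_of_not_reachable {s v : V} (h : ¬ G.Reachable v s) : harm G K s v = 0 := by
  rw [harm, rootedCountReach_eq_zero_of_not_reachable K h, zero_div]

lemma sum_harm (hK : Covers G K) (v : V) : ∑ s ∈ K, harm G K s v = 1 := by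
  simp only [harm]
  rw [← sum_div, sum_rootedCountReach, div_self (rootedCount_pos hK).ne']

lemma lap_harm [DecidableEq V] {s u : V} (hs : s ∈ K) (hu : u ∉ K) : lap G (harm G K s) u = 0 := by
  unfold harm
  rw [lap_div, lap_rootedCountReach G hu hs, zero_div]

lemma rootedCount_insert [DecidableEq V] {u : V} (hK : Covers G K) :
    rootedCount G (insert u K) = rootedCount G K * green G K u u := by
  rw [green, rootedCountReach_self, mul_div_cancel₀ _ (rootedCount_pos hK).ne']

lemma green_self_pos [DecidableEq V] {u : V} (hK : Covers G K) : 0 < green G K u u := by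
  rw [green, rootedCountReach_self]
  exact div_pos (rootedCount_pos (hK.mono (subset_insert _ _))) (rootedCount_pos hK)

lemma green_of_mem [DecidableEq V] {u k : V} (hu : u ∉ K) (hk : k ∈ K) : green G K u k = 0 := by
  classical
  rw [green, rootedCountReach_eq_zero G (mem_insert_of_mem hk) (mem_insert_self _ _), zero_div]
  rintro rfl; exact hu hk

lemma lap_green_of_ne [DecidableEq V] {u v : V} (hv : v ∉ K) (h : v ≠ u) :
    lap G (green G K u) v = 0 := by
  unfold green
  rw [lap_div, lap_rootedCountReach G (by simp [hv, h]) (mem_insert_self _ _), zero_div]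

lemma lap_green_self [DecidableEq V] {u : V} (hK : Covers G K) (hu : u ∉ K) :
    lap G (green G K u) u = 1 := by
  classical
  unfold green
  rw [lap_div, div_eq_one_iff_eq (rootedCount_pos hK).ne', rootedCount, sum_rootedForests G hu,
    lap]
  refine sum_congr rfl fun u' _ => ?_
  refine if_congr Iff.rfl ?_ rfl
  rw [rootedCountReach_self, rootedCount, rootedCountReach, ← sum_sub_distrib]
  refine sum_congr rfl fun F _ => ?_
  by_cases h : F.Reachable u u'
  · simp [h, h.symm]
  · have : ¬ F.Reachable u' u := fun h' => h h'.symm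
    simp [h, this]

/-- Representation by the Green function: the defining property of `green`, tested against a
function that vanishes on `K`. -/
lemma sum_mul_lap_green [DecidableEq V] (hK : Covers G K) {u : V} (hu : u ∉ K) {f : V → ℝ}
    (hf : ∀ k ∈ K, f k = 0) : ∑ v, f v * lap G (green G K u) v = f u := by
  rw [sum_eq_single_of_mem u (mem_univ _), lap_green_self hK hu, mul_one]
  intro v _ hvu
  by_cases hv : v ∈ K
  · rw [hf v hv, zero_mul]
  · rw [lap_green_of_ne hv hvu, mul_zero]

lemma green_comm [DecidableEq V] (hK : Covers G K) {u v : V} (hu : u ∉ K) (hv : v ∉ K) :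
    green G K u v = green G K v u := by
  rw [← sum_mul_lap_green hK hv (f := green G K u) (fun k hk => green_of_mem hu hk),
    sum_mul_lap_comm, sum_mul_lap_green hK hu (fun k hk => green_of_mem hv hk)]

/-- Green's identity: the harmonic measure of the root `s` is the flow of the Green function
into `s`. -/
lemma lap_green_root [DecidableEq V] (hK : Covers G K) {u s : V} (hu : u ∉ K) (hs : s ∈ K) :
    lap G (green G K u) s = -harm G K s u := by
  classical
  have h1 : ∑ v, harm G K s v * lap G (green G K u) v = 0 := by
    rw [sum_mul_lap_comm]
    refine sum_eq_zero fun v _ => ?_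
    by_cases hv : v ∈ K
    · rw [green_of_mem hu hv, zero_mul]
    · rw [lap_harm hs hv, mul_zero]
  have hus : u ≠ s := by rintro rfl; exact hu hs
  rw [sum_eq_add_of_mem u s (mem_univ _) (mem_univ _) hus, lap_green_self hK hu,
    harm_self hK] at h1
  · linarith
  · rintro v - ⟨hvu, hvs⟩
    by_cases hv : v ∈ K
    · rw [harm_of_ne hs hv hvs, zero_mul]
    · rw [lap_green_of_ne hv hvu, mul_zero]

lemma harm_insert [DecidableEq V] (hK : Covers G K) {u s : V} (hu : u ∉ K) (hs : s ∈ K) (v : V) :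
    harm G (insert u K) s v = harm G K s v - harm G K s u / green G K u u * green G K u v := by
  have hK' : Covers G (insert u K) := hK.mono (subset_insert _ _)
  have hus : u ≠ s := by rintro rfl; exact hu hs
  have hg := (green_self_pos (u := u) hK).ne'
  have := eq_zero_of_lap_eq_zero hK' (f := fun v => harm G (insert u K) s v - 1 *
    (harm G K s v - harm G K s u / green G K u u * green G K u v)) ?_ ?_ v
  · linarith
  · intro k hk
    rcases mem_insert.1 hk with rfl | hkK
    · rw [harm_of_ne (mem_insert_of_mem hs) hk hus]
      field_simp
      ring
    · rw [green_of_mem hu hkK]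
      by_cases hks : k = s
      · subst hks
        rw [harm_self hK, harm_self hK']; ring
      · rw [harm_of_ne (mem_insert_of_mem hs) hk hks, harm_of_ne hs hkK hks]; ring
  · intro w hw
    have hw' := hw
    rw [mem_insert, not_or] at hw
    rw [lap_sub_mul, lap_sub_mul, lap_harm (mem_insert_of_mem hs) hw', lap_harm hs hw.2,
      lap_green_of_ne hw.2 hw.1]
    ring

lemma green_insert [DecidableEq V] (hK : Covers G K) {u v : V} (hu : u ∉ K)
    (hv : v ∉ insert u K) (w : V) :
    green G (insert u K) v w =
      green G K v w - green G K v u / green G K u u * green G K u w := by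
  have hK' : Covers G (insert u K) := hK.mono (subset_insert _ _)
  have hv2 := hv
  rw [mem_insert, not_or] at hv2
  have hg := (green_self_pos (u := u) hK).ne'
  have := eq_zero_of_lap_eq_zero hK' (f := fun w => green G (insert u K) v w - 1 *
    (green G K v w - green G K v u / green G K u u * green G K u w)) ?_ ?_ w
  · linarith
  · intro k hk
    rw [green_of_mem hv hk]
    rcases mem_insert.1 hk with rfl | hkK
    · field_simp
      ring
    · rw [green_of_mem hu hkK, green_of_mem hv2.2 hkK]; ring
  · intro x hx
    have hx' := hx
    rw [mem_insert, not_or] at hx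
    rw [lap_sub_mul, lap_sub_mul, lap_green_of_ne hx.2 hx.1]
    by_cases hxv : x = v
    · subst hxv
      rw [lap_green_self hK' hv, lap_green_self hK hv2.2]; ring
    · rw [lap_green_of_ne hx' hxv, lap_green_of_ne hx.2 hxv]; ring

/-- The response matrix of the network with boundary `K`: off the diagonal, the effective
conductance between the two boundary vertices. -/
noncomputable def resp (G : SimpleGraph V) (K : Finset V) (i j : V) : ℝ :=
  -lap G (harm G K j) i

lemma resp_comm [DecidableEq V] (hK : Covers G K) {i j : V} (hi : i ∈ K) (hj : j ∈ K) :
    resp G K i j = resp G K j i := by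
  have h : ∀ {i j}, i ∈ K → j ∈ K →
      ∑ v, harm G K i v * lap G (harm G K j) v = lap G (harm G K j) i := by
    intro i j hi hj
    rw [sum_eq_single_of_mem i (mem_univ _), harm_self hK, one_mul]
    intro v _ hvi
    by_cases hv : v ∈ K
    · rw [harm_of_ne hi hv hvi, zero_mul]
    · rw [lap_harm hj hv, mul_zero]
  rw [resp, resp, ← h hi hj, ← h hj hi, sum_mul_lap_comm]

lemma resp_insert [DecidableEq V] (hK : Covers G K) {u i j : V} (hu : u ∉ K) (hi : i ∈ K)
    (hj : j ∈ K) :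
    resp G (insert u K) i j = resp G K i j - harm G K i u * harm G K j u / green G K u u := by
  have : harm G (insert u K) j = fun v => harm G K j v -
      harm G K j u / green G K u u * green G K u v := funext fun v => harm_insert hK hu hj v
  rw [resp, this, lap_sub_mul, lap_green_root hK hu hi, resp]
  ring

/-- Turning the root `i` into a non-root: forests in which it is then connected to `j`. -/
lemma rootedCountReach_erase [DecidableEq V] {K : Finset V} {i j : V} (hi : i ∉ K) (hj : j ∈ K)
    (hK : Covers G (insert i K)) :
    rootedCountReach G K i j = rootedCount G (insert i K) * resp G (insert i K) i j := by
  classical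
  have hij : i ≠ j := by rintro rfl; exact hi hj
  rw [rootedCountReach_self_of_not_mem G hi hj, resp, lap, ← sum_neg_distrib, mul_sum]
  refine sum_congr rfl fun v _ => ?_
  split_ifs
  · rw [harm_of_ne (by simp [hj]) (by simp) hij, harm]
    have := (rootedCount_pos hK).ne'
    field_simp
    ring
  · simp

lemma rootedCount_erase [DecidableEq V] {K : Finset V} {i : V} (hi : i ∉ K)
    (hK : Covers G (insert i K)) :
    rootedCount G K = rootedCount G (insert i K) * -resp G (insert i K) i i := by
  classical
  rw [rootedCount, sum_rootedForests G hi, resp, neg_neg, lap, mul_sum]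
  refine sum_congr rfl fun v _ => ?_
  split_ifs
  · have h0 := (rootedCount_pos hK).ne'
    rw [harm_self hK, harm, mul_sub, mul_one, mul_div_cancel₀ _ h0, rootedCount,
      rootedCountReach, ← sum_sub_distrib]
    refine sum_congr rfl fun F _ => ?_
    by_cases h : F.Reachable i v
    · simp [h, h.symm]
    · have : ¬ F.Reachable v i := fun h' => h h'.symm
      simp [h, this]
  · simp

/-- Turning two roots `i` and `k` into non-roots: forests in which `i` is then connected to
`j`. -/
lemma rootedCountReach_erase_erase [DecidableEq V] {K : Finset V} {i j k : V}
    (hk : k ∉ K) (hi : i ∉ insert k K) (hj : j ∈ K)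
    (hK : Covers G K) :
    rootedCountReach G K i j = rootedCount G (insert k (insert i K)) *
      (resp G (insert k (insert i K)) i k * resp G (insert k (insert i K)) j k -
        resp G (insert k (insert i K)) k k * resp G (insert k (insert i K)) i j) := by
  classical
  have hiK : i ∉ K := fun h => hi (mem_insert_of_mem h)
  have hik : i ≠ k := by rintro rfl; exact hi (mem_insert_self _ _)
  have hk' : k ∉ insert i K := by simp [hk, hik.symm]
  have hK1 : Covers G (insert i K) := hK.mono (subset_insert _ _)
  have hK2 : Covers G (insert k (insert i K)) := hK1.mono (subset_insert _ _)
  rw [rootedCountReach_erase hiK hj hK1]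
  set L := insert i K with hL
  have hiL : i ∈ L := mem_insert_self _ _
  have hjL : j ∈ L := mem_insert_of_mem hj
  have h0 := (rootedCount_pos hK1).ne'
  have h0' := (rootedCount_pos hK2).ne'
  have e1 : rootedCount G L = rootedCount G (insert k L) * -resp G (insert k L) k k :=
    rootedCount_erase hk' hK2
  have hkk : resp G (insert k L) k k ≠ 0 := by
    intro h; rw [h] at e1; simp at e1; exact h0 e1
  have e2 : ∀ s ∈ L, harm G L s k = resp G (insert k L) k s / -resp G (insert k L) k k := by
    intro s hs
    rw [harm, rootedCountReach_erase hk' hs hK2, e1]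
    field_simp
  have e3 : green G L k k = 1 / -resp G (insert k L) k k := by
    have h4 := rootedCount_insert (u := k) hK1
    rw [e1] at h4
    have : 1 = -resp G (insert k L) k k * green G L k k := by
      apply mul_left_cancel₀ h0'
      linarith
    field_simp
    linarith
  have e4 : resp G (insert k L) i j =
      resp G L i j - harm G L i k * harm G L j k / green G L k k :=
    resp_insert hK1 hk' hiL hjL
  rw [e2 i hiL, e2 j hjL, e3, resp_comm hK2 (mem_insert_self _ _) (mem_insert_of_mem hiL),
    resp_comm hK2 (mem_insert_self _ _) (mem_insert_of_mem hjL)] at e4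
  have e5 : resp G L i j = resp G (insert k L) i j +
      resp G (insert k L) i k * resp G (insert k L) j k / -resp G (insert k L) k k := by
    rw [e4]; field_simp; ring
  rw [e1, e5]
  field_simp
  ring

end
end

/-! ### Edge counts and the free component -/

section

variable {V : Type*}

/-- Every component of `F` contains exactly one vertex of `S`, except for one component, the
*free* component, that contains none. -/
def HasFreeComponent [DecidableEq V] (F : SimpleGraph V) (S : Finset V) : Prop :=
  ∃ w ∉ S, IsRooted F (insert w S)

/-- Any vertex of the free component can serve as its root. -/
lemma IsRooted.change_root [DecidableEq V] {F : SimpleGraph V} {S : Finset V} {w v : V}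
    (h : IsRooted F (insert w S)) (hw : w ∉ S) : (v ∉ S ∧ IsRooted F (insert v S)) ↔
      F.Reachable w v := by
  constructor
  · rintro ⟨hv, h'⟩
    obtain ⟨k, hk, hr⟩ := h.exists_root v
    rcases mem_insert.1 hk with rfl | hk
    · exact hr.symm
    · have := h'.eq_of_reachable v (mem_insert_self _ _) k (mem_insert_of_mem hk) hr
      exact absurd (this ▸ hk) hv
  · intro hwv
    refine ⟨fun hv => ?_, ⟨fun x => ?_, fun k hk l hl hkl => ?_⟩⟩
    · have := h.eq_of_reachable w (mem_insert_self _ _) v (mem_insert_of_mem hv) hwv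
      exact hw (this ▸ hv)
    · obtain ⟨k, hk, hr⟩ := h.exists_root x
      rcases mem_insert.1 hk with rfl | hk
      · exact ⟨v, mem_insert_self _ _, hr.trans hwv⟩
      · exact ⟨k, mem_insert_of_mem hk, hr⟩
    · rcases mem_insert.1 hk with rfl | hk'
      · rcases mem_insert.1 hl with rfl | hl'
        · rfl
        · have := h.eq_of_reachable w (mem_insert_self _ _) l (mem_insert_of_mem hl')
            (hwv.trans hkl)
          exact absurd (this ▸ hl') hw
      · rcases mem_insert.1 hl with rfl | hl'
        · have := h.eq_of_reachable w (mem_insert_self _ _) k (mem_insert_of_mem hk')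
            (hwv.trans hkl.symm)
          exact absurd (this ▸ hk') hw
        · exact h.eq_of_reachable k (mem_insert_of_mem hk') l (mem_insert_of_mem hl') hkl

variable [Fintype V]

lemma IsRooted.ncard_edgeSet_add_card [DecidableEq V] {F : SimpleGraph V} {K : Finset V}
    (hF : IsRooted F K) (ha : F.IsAcyclic) : F.edgeSet.ncard + #K = Fintype.card V := by
  induction h : #Kᶜ generalizing F K with
  | zero =>
    rw [card_eq_zero, compl_eq_empty_iff] at h
    subst h
    have : F = ⊥ := by
      ext x y
      simp only [bot_adj, iff_false]
      exact fun hxy => hxy.ne (hF.eq_of_reachable x (mem_univ _) y (mem_univ _) hxy.reachable)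
    subst this
    simp
  | succ n ih =>
    have hne : Kᶜ.Nonempty := card_pos.1 (by omega)
    obtain ⟨u, hu⟩ := hne
    rw [mem_compl] at hu
    obtain ⟨u', hadj, hr, hnr⟩ := hF.exists_deleteEdges ha hu
    have hc : #(insert u K)ᶜ = n := by
      have h1 := card_compl_add_card K
      have h2 := card_compl_add_card (insert u K)
      rw [card_insert_of_notMem hu] at h2
      omega
    have := ih hr (ha.anti (deleteEdges_le _)) hc
    rw [card_insert_of_notMem hu, edgeSet_deleteEdges,
      Set.ncard_sdiff_singleton_of_mem (by simpa using hadj)] at this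
    have hpos : 0 < F.edgeSet.ncard := (Set.ncard_pos (Set.toFinite _)).2
      ⟨s(u, u'), by simpa using hadj⟩
    omega

open scoped Classical in
/-- Handshaking: each edge is counted once in each direction. -/
lemma sum_sum_adj (F : SimpleGraph V) :
    ∑ u, ∑ v, (if F.Adj u v then (1 : ℝ) else 0) = 2 * F.edgeSet.ncard := by
  have h := F.sum_degrees_eq_twice_card_edges
  have h2 : F.edgeSet.ncard = #F.edgeFinset := by
    rw [← coe_edgeFinset, Set.ncard_coe_finset]
  rw [h2]
  have h3 : ∀ u, ∑ v, (if F.Adj u v then (1 : ℝ) else 0) = F.degree u := by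
    intro u
    rw [sum_boole, ← card_neighborFinset_eq_degree, neighborFinset_eq_filter]
  simp only [h3]
  exact_mod_cast h

open scoped Classical in
/-- A tree has one vertex more than it has edges; here the tree is the component of `w`, and its
edges are counted twice. -/
lemma card_component_sub_edges [DecidableEq V] {F : SimpleGraph V} {S : Finset V} {w : V}
    (h : IsRooted F (insert w S)) (ha : F.IsAcyclic) (hw : w ∉ S) :
    ∑ v, (if F.Reachable w v then (1 : ℝ) else 0) -
      (1 / 2) * ∑ u, ∑ v, (if F.Reachable w u ∧ F.Adj u v then (1 : ℝ) else 0) = 1 := by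
  set W : Finset V := univ.filter fun v => F.Reachable w v with hW
  -- Delete the edges of the component of `w`.
  obtain ⟨F', hF'⟩ : ∃ F' : SimpleGraph V, ∀ x y, F'.Adj x y ↔ F.Adj x y ∧ ¬ F.Reachable w x :=
    ⟨{ Adj := fun x y => F.Adj x y ∧ ¬ F.Reachable w x
       symm := ⟨fun x y hxy => ⟨hxy.1.symm, fun hwy => hxy.2 (hwy.trans hxy.1.symm.reachable)⟩⟩
       loopless := ⟨fun x hx => F.loopless.irrefl x hx.1⟩ }, fun _ _ => Iff.rfl⟩
  have hle : F' ≤ F := fun x y hxy => ((hF' x y).1 hxy).1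
  have hkeep : ∀ {x y}, F.Reachable x y → ¬ F.Reachable w x → F'.Reachable x y := by
    rintro x y ⟨p⟩ hx
    induction p with
    | nil => exact Reachable.refl _
    | cons hadj p ih =>
      have h1 := (hF' _ _).2 ⟨hadj, hx⟩
      exact h1.reachable.trans (ih fun h2 => hx (h2.trans hadj.symm.reachable))
  have hdisc : ∀ {x y}, F'.Reachable x y → F.Reachable w x → x = y := by
    rintro x y ⟨p⟩ hx
    cases p with
    | nil => rfl
    | cons hadj p => exact absurd hx ((hF' _ _).1 hadj).2
  have hSW : Disjoint S W := by
    rw [Finset.disjoint_left]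
    intro v hv hvW
    have := h.eq_of_reachable w (mem_insert_self _ _) v (mem_insert_of_mem hv)
      (by simpa [hW] using hvW)
    exact hw (this ▸ hv)
  have hroot : IsRooted F' (S ∪ W) := by
    refine ⟨fun v => ?_, fun k hk l hl hkl => ?_⟩
    · by_cases hv : F.Reachable w v
      · exact ⟨v, mem_union_right _ (by simpa [hW] using hv), Reachable.refl _⟩
      · obtain ⟨k, hk, hr⟩ := h.exists_root v
        rcases mem_insert.1 hk with rfl | hk
        · exact absurd hr.symm hv
        · exact ⟨k, mem_union_left _ hk, hkeep hr hv⟩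
    · by_cases hkW : F.Reachable w k
      · exact hdisc hkl hkW
      · by_cases hlW : F.Reachable w l
        · exact (hdisc hkl.symm hlW).symm
        · have hkS : k ∈ S := (mem_union.1 hk).resolve_right (by simpa [hW] using hkW)
          have hlS : l ∈ S := (mem_union.1 hl).resolve_right (by simpa [hW] using hlW)
          exact h.eq_of_reachable k (mem_insert_of_mem hkS) l (mem_insert_of_mem hlS)
            (hkl.mono hle)
  have c1 := h.ncard_edgeSet_add_card ha
  have c2 := hroot.ncard_edgeSet_add_card (ha.anti hle)
  rw [card_insert_of_notMem hw] at c1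
  rw [card_union_of_disjoint hSW] at c2
  have d1 := sum_sum_adj F
  have d2 := sum_sum_adj F'
  have d3 : ∑ u, ∑ v, (if F.Reachable w u ∧ F.Adj u v then (1 : ℝ) else 0) =
      ∑ u, ∑ v, (if F.Adj u v then (1 : ℝ) else 0) -
        ∑ u, ∑ v, (if F'.Adj u v then (1 : ℝ) else 0) := by
    rw [← sum_sub_distrib]
    refine sum_congr rfl fun u _ => ?_
    rw [← sum_sub_distrib]
    refine sum_congr rfl fun v _ => ?_
    by_cases h1 : F.Adj u v <;> by_cases h2 : F.Reachable w u <;> simp [hF', h1, h2]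
  have d4 : ∑ v, (if F.Reachable w v then (1 : ℝ) else 0) = #W := by
    rw [sum_boole]
  rw [d3, d4, d1, d2]
  have c1' : (F.edgeSet.ncard : ℝ) + (#S + 1) = Fintype.card V := by exact_mod_cast c1
  have c2' : (F'.edgeSet.ncard : ℝ) + (#S + #W) = Fintype.card V := by exact_mod_cast c2
  linarith

open scoped Classical in
/-- The forests with one free component, counted through rooted forests: the free component is a
tree, so counting it with weight `1` amounts to counting each of its vertices with weight `1` and
each of its edges with weight `-1`. Marking a vertex turns it into a root; deleting a marked edge
turns both of its ends into roots. -/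
theorem sum_hasFreeComponent [DecidableEq V] (G : SimpleGraph V) {S : Finset V} {s : V}
    (hs : s ∈ S) (x : V) :
    ∑ F ∈ forests G, (if HasFreeComponent F S ∧ F.Reachable x s then (1 : ℝ) else 0) =
      ∑ v ∈ Sᶜ, rootedCountReach G (insert v S) x s -
        (1 / 2) * ∑ u ∈ Sᶜ, ∑ v ∈ Sᶜ, if G.Adj u v then
          rootedCountReach G (insert v (insert u S)) x s else 0 := by
  have e1 : ∑ v ∈ Sᶜ, rootedCountReach G (insert v S) x s = ∑ F ∈ forests G, ∑ v,
      if (v ∉ S ∧ IsRooted F (insert v S)) ∧ F.Reachable x s then (1 : ℝ) else 0 := by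
    rw [sum_comm, ← sum_subset (subset_univ Sᶜ)]
    · refine sum_congr rfl fun v hv => ?_
      rw [rootedCountReach, rootedForests, sum_filter]
      refine sum_congr rfl fun F _ => ?_
      simp only [mem_compl.1 hv, not_false_eq_true, true_and, ite_and]
      congr!
    · intro v _ hv
      rw [mem_compl, not_not] at hv
      simp [hv]
  have e2 : ∀ u ∈ Sᶜ, ∀ v ∈ Sᶜ, (if G.Adj u v then
        rootedCountReach G (insert v (insert u S)) x s else 0) = ∑ F ∈ forests G,
        if ((u ∉ S ∧ IsRooted F (insert u S)) ∧ F.Adj u v) ∧ F.Reachable x s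
          then (1 : ℝ) else 0 := by
    intro u hu v hv
    rw [mem_compl] at hu hv
    by_cases hadj : G.Adj u v
    · have hvu : v ∉ insert u S := by simp [hv, hadj.ne']
      have hus : ∀ F, IsRooted F (insert v (insert u S)) → ¬ F.Reachable u v := fun F hF h =>
        hadj.ne (hF.eq_of_reachable u (by simp) v (by simp) h)
      have hc : rootedCountReach G (insert v (insert u S)) x s = ∑ _F ∈ (rootedForests G
          (insert v (insert u S))).filter (fun F => F.Reachable x s), (1 : ℝ) := by
        rw [sum_filter, rootedCountReach]
        congr!
      rw [if_pos hadj, hc, ← sum_filter]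
      refine sum_nbij (fun F => F ⊔ edge u v) ?_ ?_ ?_ (fun _ _ => rfl)
      · intro F hF
        simp only [mem_filter, mem_rootedForests, mem_forests] at hF ⊢
        obtain ⟨⟨⟨hle, hac⟩, hr⟩, hx⟩ := hF
        refine ⟨⟨sup_le hle ((edge_le_iff _).2 (Or.inr hadj)),
          hac.sup_edge_of_not_reachable (hus F hr)⟩, ⟨⟨hu, ?_⟩, sup_edge_adj hadj.ne⟩,
          hx.mono le_sup_left⟩
        rw [edge_comm]
        exact hr.sup_edge hvu (fun h => hus F hr h.symm)
      · intro F hF F' hF' he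
        simp only [coe_filter, mem_rootedForests, Set.mem_ofPred_eq] at hF hF'
        have he : F ⊔ edge u v = F' ⊔ edge u v := he
        rw [← sup_edge_deleteEdges (F := F) (u := u) (v := v)
          (fun h => hus F hF.1.2 h.reachable), he,
          sup_edge_deleteEdges (fun h => hus F' hF'.1.2 h.reachable)]
      · intro F hF
        simp only [coe_filter, mem_forests, Set.mem_ofPred_eq] at hF
        obtain ⟨⟨hle, hac⟩, ⟨⟨-, hr⟩, hFadj⟩, hx⟩ := hF
        refine ⟨F.deleteEdges {s(u, v)}, ?_, deleteEdges_sup_edge hFadj⟩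
        simp only [coe_filter, mem_rootedForests, Set.mem_ofPred_eq]
        obtain ⟨v', hadj', hr', hnr'⟩ := hr.exists_deleteEdges hac hvu
        have hvv : v' = u := by
          by_contra hne
          refine hnr' ?_
          have hk : (F.deleteEdges {s(v, v')}).Adj v u := by
            rw [deleteEdges_adj]
            refine ⟨hFadj.symm, ?_⟩
            simp only [Set.mem_singleton_iff, Sym2.eq_iff]
            rintro (⟨-, h⟩ | ⟨h, h2⟩)
            · exact hne h.symm
            · exact hadj.ne h2
          have := hr'.eq_of_reachable v (by simp) u (by simp) hk.reachable
          exact absurd this hadj.ne'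
        subst hvv
        rw [Sym2.eq_swap] at hr'
        refine ⟨⟨⟨(deleteEdges_le _).trans hle, hac.anti (deleteEdges_le _)⟩, hr'⟩, ?_⟩
        rw [← deleteEdges_sup_edge hFadj, reachable_sup_edge_iff] at hx
        have hs1 : ∀ t ∈ insert v (insert v' S), t ∉ S →
            ¬ (F.deleteEdges {s(v', v)}).Reachable t s := by
          intro t ht htS h
          have := hr'.eq_of_reachable t ht s (by simp [hs]) h
          exact htS (this ▸ hs)
        rcases hx with h | ⟨-, h⟩ | ⟨-, h⟩
        · exact h
        · exact absurd h (hs1 v (by simp) hv)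
        · exact absurd h (hs1 v' (by simp) hu)
    · rw [if_neg hadj]
      symm
      refine sum_eq_zero fun F hF => if_neg fun h => hadj ?_
      exact (mem_forests.1 hF).1 h.1.2
  have e3 : ∑ u ∈ Sᶜ, ∑ v ∈ Sᶜ, (if G.Adj u v then
        rootedCountReach G (insert v (insert u S)) x s else 0) = ∑ F ∈ forests G, ∑ u, ∑ v,
        if ((u ∉ S ∧ IsRooted F (insert u S)) ∧ F.Adj u v) ∧ F.Reachable x s
          then (1 : ℝ) else 0 := by
    rw [sum_congr rfl fun u hu => sum_congr rfl (e2 u hu)]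
    have : ∀ F : SimpleGraph V, (∑ u, ∑ v,
        if ((u ∉ S ∧ IsRooted F (insert u S)) ∧ F.Adj u v) ∧ F.Reachable x s
          then (1 : ℝ) else 0) = ∑ u ∈ Sᶜ, ∑ v ∈ Sᶜ,
        if ((u ∉ S ∧ IsRooted F (insert u S)) ∧ F.Adj u v) ∧ F.Reachable x s
          then (1 : ℝ) else 0 := by
      intro F
      rw [← sum_subset (subset_univ Sᶜ)]
      · refine sum_congr rfl fun u hu => (sum_subset (subset_univ Sᶜ) ?_).symm
        intro v _ hv
        rw [mem_compl, not_not] at hv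
        rw [if_neg]
        rintro ⟨⟨⟨hu', hr⟩, hadj⟩, -⟩
        exact hadj.ne (hr.eq_of_reachable u (by simp) v (by simp [hv]) hadj.reachable)
      · intro u _ hu
        rw [mem_compl, not_not] at hu
        simp [hu]
    simp only [this]
    rw [sum_comm (s := forests G)]
    refine sum_congr rfl fun u _ => ?_
    rw [sum_comm]
  rw [e1, e3, mul_sum, ← sum_sub_distrib]
  refine sum_congr rfl fun F hF => ?_
  have hac := (mem_forests.1 hF).2
  by_cases hx : F.Reachable x s
  · simp only [hx, and_true]
    by_cases hfree : HasFreeComponent F S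
    · rw [if_pos hfree]
      obtain ⟨w, hw, hr⟩ := hfree
      simp only [hr.change_root hw]
      exact (card_component_sub_edges hr hac hw).symm
    · have : ∀ v, ¬ (v ∉ S ∧ IsRooted F (insert v S)) := fun v hv => hfree ⟨v, hv.1, hv.2⟩
      simp [hfree, this]
  · simp [hx]

end

/-! ### The first-order coefficient -/

section

variable {V : Type*} [DecidableEq V]

/-- The set `R` contains `a`, `b`, `c` and one further vertex of each component of `G` other than
the one that contains `a`, `b`, `c`. -/
structure IsRootSystem (G : SimpleGraph V) (R : Finset V) (a b c : V) : Prop where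
  mem_a : a ∈ R
  mem_b : b ∈ R
  mem_c : c ∈ R
  ab : a ≠ b
  ac : a ≠ c
  bc : b ≠ c
  covers : Covers G R
  reach_ab : G.Reachable a b
  reach_ac : G.Reachable a c
  /-- Two different roots in one component of `G` are among `a`, `b`, `c`. -/
  sep : ∀ k ∈ R, ∀ l ∈ R, G.Reachable k l → k ≠ l →
    k ∈ ({a, b, c} : Finset V) ∧ l ∈ ({a, b, c} : Finset V)

lemma covers_erase_erase {G : SimpleGraph V} {R : Finset V} {a b c : V}
    (hR : IsRootSystem G R a b c) : Covers G ((R.erase a).erase c) := by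
  intro x
  obtain ⟨k, hk, hr⟩ := hR.covers x
  by_cases hka : k = a
  · exact ⟨b, by simp [hR.mem_b, hR.bc, hR.ab.symm], hr.trans (hka ▸ hR.reach_ab)⟩
  · by_cases hkc : k = c
    · exact ⟨b, by simp [hR.mem_b, hR.bc, hR.ab.symm],
        hr.trans (hkc ▸ hR.reach_ac.symm.trans hR.reach_ab)⟩
    · exact ⟨k, by simp [hka, hkc, hk], hr⟩

variable [Fintype V]

/-- The minor of the harmonic functions of the roots `i` and `j` at the vertices `u` and `v`. -/
noncomputable def minor (G : SimpleGraph V) (R : Finset V) (i j u v : V) : ℝ :=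
  harm G R i u * harm G R j v - harm G R j u * harm G R i v

open scoped Classical in
/-- The correction of first order in the inverse parameter, relative to the square of the leading
number of forests. -/
noncomputable def rho (G : SimpleGraph V) (R : Finset V) (a b c : V) : ℝ :=
  (1 / 2) * ∑ u, ∑ v, if G.Adj u v then minor G R a c u v * minor G R b c u v else 0

/-- The number of forests with a free component, relative to the roots `S`, in which `i` and `j` are
connected. -/
noncomputable def freeCount (G : SimpleGraph V) (S : Finset V) (i j : V) : ℝ :=
  open scoped Classical in
  ∑ F ∈ forests G, if HasFreeComponent F S ∧ F.Reachable i j then (1 : ℝ) else 0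

section
variable {G : SimpleGraph V} {R : Finset V} {a b c : V}

open scoped Classical in
/-- In `sum_hasFreeComponent`, the marked vertices and edges avoid `i`. -/
lemma freeCount_eq {S : Finset V} {i j : V} (hi : i ∉ S) (hj : j ∈ S) :
    freeCount G S i j = ∑ v ∈ (insert i S)ᶜ, rootedCountReach G (insert v S) i j -
        (1 / 2) * ∑ u ∈ (insert i S)ᶜ, ∑ v ∈ (insert i S)ᶜ, if G.Adj u v then
          rootedCountReach G (insert v (insert u S)) i j else 0 := by
  have hij : i ≠ j := by rintro rfl; exact hi hj
  have hz : ∀ L : Finset V, i ∈ L → j ∈ L → rootedCountReach G L i j = 0 := fun L h1 h2 =>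
    rootedCountReach_eq_zero G h1 h2 hij
  have hc : Sᶜ = insert i (insert i S)ᶜ := by
    ext x
    by_cases hx : x = i
    · subst hx; simp [hi]
    · simp [hx]
  have hn : i ∉ (insert i S)ᶜ := by simp
  have hsum : ∀ f : V → ℝ, f i = 0 → ∑ v ∈ Sᶜ, f v = ∑ v ∈ (insert i S)ᶜ, f v := by
    intro f hf
    rw [hc, sum_insert hn, hf, zero_add]
  rw [freeCount, sum_hasFreeComponent G hj, hsum _ (hz _ (by simp) (by simp [hj])), hsum]
  · congr 2
    refine sum_congr rfl fun u _ => hsum _ ?_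
    rw [hz _ (by simp) (by simp [hj]), ite_self]
  · refine sum_eq_zero fun v _ => ?_
    rw [hz _ (by simp) (by simp [hj]), ite_self]

/-- On the component of `a`, `b`, `c` the harmonic functions of these roots sum to `1`; on the other
components that of `c` vanishes. -/
lemma harm_mul_sum (hR : IsRootSystem G R a b c) {u v : V} (h : G.Reachable u v) :
    harm G R c u * (harm G R a v + harm G R b v + harm G R c v) = harm G R c u := by
  by_cases hu : G.Reachable u c
  · have h1 := sum_harm hR.covers v
    have h2 : ∑ s ∈ R, harm G R s v = ∑ s ∈ ({a, b, c} : Finset V), harm G R s v := by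
      symm
      refine sum_subset ?_ ?_
      · intro x hx
        simp only [mem_insert, mem_singleton] at hx
        rcases hx with rfl | rfl | rfl
        · exact hR.mem_a
        · exact hR.mem_b
        · exact hR.mem_c
      · intro s hs hs'
        refine harm_eq_zero_of_not_reachable fun hvs => hs' ?_
        have hcs : G.Reachable c s := hu.symm.trans (h.trans hvs)
        by_cases hcs' : c = s
        · simp [← hcs']
        · exact (hR.sep c hR.mem_c s hs hcs hcs').2
    rw [sum_insert (by simp [hR.ab, hR.ac]), sum_insert (by simp [hR.bc]), sum_singleton] at h2
    rw [add_assoc, ← h2, h1, mul_one]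
  · rw [harm_eq_zero_of_not_reachable hu, zero_mul]

lemma neg_resp_self (hR : IsRootSystem G R a b c) :
    -resp G R c c = resp G R a c + resp G R b c := by
  classical
  have hab := hR.ac
  rw [resp_comm hR.covers hR.mem_a hR.mem_c, resp_comm hR.covers hR.mem_b hR.mem_c, resp, resp,
    resp, neg_neg]
  simp only [lap, ← sum_neg_distrib]
  rw [← sum_add_distrib]
  refine sum_congr rfl fun v _ => ?_
  split_ifs with h
  · have h1 := harm_mul_sum hR h.reachable
    rw [harm_self hR.covers] at h1 ⊢
    rw [harm_of_ne hR.mem_a hR.mem_c hR.ac.symm, harm_of_ne hR.mem_b hR.mem_c hR.bc.symm]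
    linarith
  · simp

/-- The numbers of forests rooted at `R ∪ {v}`, up to turning roots into non-roots. -/
lemma counts_insert (hR : IsRootSystem G R a b c) {v : V} (hv : v ∉ R) {i j : V} (hi : i ∈ R)
    (hj : j ∈ R) (hij : i ≠ j) :
    rootedCountReach G (insert v (R.erase i)) i j = rootedCount G R *
      (green G R v v * resp G R i j - harm G R i v * harm G R j v) := by
  have hvi : v ≠ i := by rintro rfl; exact hv hi
  have h1 : insert i (insert v (R.erase i)) = insert v R := by
    rw [insert_comm, insert_erase hi]
  have h2 : Covers G (insert v R) := hR.covers.mono (subset_insert _ _)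
  have hg := (green_self_pos (u := v) hR.covers).ne'
  rw [rootedCountReach_erase (by simp [hvi.symm]) (by simp [hij.symm, hj]) (h1 ▸ h2), h1,
    resp_insert hR.covers hv hi hj, rootedCount_insert hR.covers]
  field_simp

/-- The numbers of forests rooted at `R ∪ L` after `a` and `c` are turned into non-roots. -/
lemma counts_erase_erase (hR : IsRootSystem G R a b c) (L : Finset V) (hL : Disjoint L R) :
    rootedCountReach G (L ∪ (R.erase a).erase c) a b = rootedCount G (L ∪ R) *
      (resp G (L ∪ R) a c * resp G (L ∪ R) b c - resp G (L ∪ R) c c * resp G (L ∪ R) a b) := by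
  have hcL : c ∉ L := fun h => Finset.disjoint_left.1 hL h hR.mem_c
  have haL : a ∉ L := fun h => Finset.disjoint_left.1 hL h hR.mem_a
  have h1 : insert c (insert a (L ∪ (R.erase a).erase c)) = L ∪ R := by
    ext x
    simp only [mem_insert, mem_union, mem_erase]
    by_cases hxa : x = a
    · subst hxa; simp [hR.mem_a]
    · by_cases hxc : x = c
      · subst hxc; simp [hR.mem_c]
      · simp [hxa, hxc]
  rw [rootedCountReach_erase_erase (k := c) (by simp [hcL]) (by simp [haL, hR.ac])
    (by simp [hR.mem_b, hR.bc, hR.ab.symm]) ((covers_erase_erase hR).mono subset_union_right), h1]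

/-- Roots added at two vertices change the response matrix by a term of rank two. -/
lemma resp_insert_insert (hR : Covers G R) {u v i j : V} (hu : u ∉ R) (hv : v ∉ insert u R)
    (hi : i ∈ R) (hj : j ∈ R) :
    resp G (insert v (insert u R)) i j = resp G R i j -
      (harm G R i u * harm G R j u * green G R v v + harm G R i v * harm G R j v * green G R u u -
        (harm G R i u * harm G R j v + harm G R i v * harm G R j u) * green G R u v) /
      (green G R u u * green G R v v - green G R u v ^ 2) ∧
    rootedCount G (insert v (insert u R)) = rootedCount G R *
      (green G R u u * green G R v v - green G R u v ^ 2) ∧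
    0 < green G R u u * green G R v v - green G R u v ^ 2 := by
  have hv2 : v ∉ R := fun h => hv (mem_insert_of_mem h)
  have hR' : Covers G (insert u R) := hR.mono (subset_insert _ _)
  have hg := green_self_pos (u := u) hR
  have hg' := green_self_pos (u := v) hR'
  have e : green G (insert u R) v v =
      (green G R u u * green G R v v - green G R u v ^ 2) / green G R u u := by
    rw [green_insert hR hu hv, green_comm hR hv2 hu]
    field_simp
  have hpos : 0 < green G R u u * green G R v v - green G R u v ^ 2 := by
    have := mul_pos hg hg'
    rwa [e, mul_div_cancel₀ _ hg.ne'] at this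
  refine ⟨?_, ?_, hpos⟩
  · rw [resp_insert hR' hv (by simp [hi]) (by simp [hj]), resp_insert hR hu hi hj, e,
      harm_insert hR hu hi, harm_insert hR hu hj]
    have h1 := hg.ne'
    have h2 := hpos.ne'
    obtain ⟨Δ, hΔ⟩ : ∃ Δ, Δ = green G R u u * green G R v v - green G R u v ^ 2 := ⟨_, rfl⟩
    have h3 : green G R v v = (Δ + green G R u v ^ 2) / green G R u u := by
      rw [hΔ]; field_simp; ring
    rw [← hΔ] at h2 ⊢
    rw [h3]
    field_simp
    ring
  · rw [rootedCount_insert hR', rootedCount_insert hR, e]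
    field_simp

/-! The next lemmas evaluate the polarization of `A C - e₂(B)` at the leading numbers of forests
and at the contribution of a marked vertex or of a marked edge of the free component. -/

/-- The contribution of a marked vertex `v`. -/
lemma vertex_contribution (hR : IsRootSystem G R a b c) {v : V} (hv : v ∉ R) :
    (resp G R a b * resp G R a c + resp G R a b * resp G R b c + resp G R a c * resp G R b c) *
        rootedCount G (insert v R) +
      rootedCountReach G (insert v ((R.erase a).erase c)) a b -
      (resp G R a b * (rootedCountReach G (insert v (R.erase a)) a c +
          rootedCountReach G (insert v (R.erase b)) b c) +
        resp G R a c * (rootedCountReach G (insert v (R.erase a)) a b +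
          rootedCountReach G (insert v (R.erase b)) b c) +
        resp G R b c * (rootedCountReach G (insert v (R.erase a)) a b +
          rootedCountReach G (insert v (R.erase a)) a c)) =
    rootedCount G R * (resp G R a b * harm G R c v) := by
  have hg := (green_self_pos (u := v) hR.covers).ne'
  have hL := counts_erase_erase hR {v} (by simpa using hv)
  rw [← insert_eq, ← insert_eq] at hL
  rw [counts_insert hR hv hR.mem_a hR.mem_c hR.ac, counts_insert hR hv hR.mem_b hR.mem_c hR.bc,
    counts_insert hR hv hR.mem_a hR.mem_b hR.ab, hL, rootedCount_insert hR.covers,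
    resp_insert hR.covers hv hR.mem_a hR.mem_c, resp_insert hR.covers hv hR.mem_b hR.mem_c,
    resp_insert hR.covers hv hR.mem_c hR.mem_c, resp_insert hR.covers hv hR.mem_a hR.mem_b]
  have h1 := harm_mul_sum hR (Reachable.refl v)
  have h2 := neg_resp_self hR
  have h3 : resp G R c c = -(resp G R a c + resp G R b c) := by linarith
  rw [h3]
  field_simp
  linear_combination rootedCount G R * resp G R a b * green G R v v * h1

/-- The contribution of a marked edge `uv`; the product of minors that makes up `rho` comes
from the Cauchy-Binet formula. -/
lemma edge_contribution (hR : IsRootSystem G R a b c) {u v : V} (hu : u ∉ R) (hv : v ∉ R)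
    (huv : G.Adj u v) :
    (resp G R a b * resp G R a c + resp G R a b * resp G R b c + resp G R a c * resp G R b c) *
        rootedCount G (insert v (insert u R)) +
      rootedCountReach G (insert v (insert u ((R.erase a).erase c))) a b -
      (resp G R a b * (rootedCountReach G (insert v (insert u (R.erase a))) a c +
          rootedCountReach G (insert v (insert u (R.erase b))) b c) +
        resp G R a c * (rootedCountReach G (insert v (insert u (R.erase a))) a b +
          rootedCountReach G (insert v (insert u (R.erase b))) b c) +
        resp G R b c * (rootedCountReach G (insert v (insert u (R.erase a))) a b +
          rootedCountReach G (insert v (insert u (R.erase a))) a c)) =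
    rootedCount G R * (resp G R a b * (harm G R c u * green G R v v + harm G R c v * green G R u u -
        (harm G R c u + harm G R c v) * green G R u v) -
      minor G R a c u v * minor G R b c u v) := by
  have hvu : v ∉ insert u R := by simp [hv, huv.ne']
  have hK : Covers G (insert v (insert u R)) :=
    hR.covers.mono ((subset_insert _ _).trans (subset_insert _ _))
  have hB : ∀ {i j}, i ∈ R → j ∈ R → i ≠ j →
      rootedCountReach G (insert v (insert u (R.erase i))) i j =
        rootedCount G (insert v (insert u R)) * resp G (insert v (insert u R)) i j := by
    intro i j hi hj hij
    have hui : u ≠ i := by rintro rfl; exact hu hi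
    have hvi : v ≠ i := by rintro rfl; exact hv hi
    have h1 : insert i (insert v (insert u (R.erase i))) = insert v (insert u R) := by
      rw [insert_comm, insert_comm i u, insert_erase hi]
    rw [rootedCountReach_erase (by simp [hvi.symm, hui.symm]) (by simp [hij.symm, hj]) (h1 ▸ hK),
      h1]
  have hL := counts_erase_erase hR {v, u} (by simp [hu, hv])
  have hins : ∀ S : Finset V, ({v, u} : Finset V) ∪ S = insert v (insert u S) := by
    intro S; ext x; simp
  rw [hins, hins] at hL
  obtain ⟨r1, hN, hpos⟩ := resp_insert_insert hR.covers hu hvu hR.mem_a hR.mem_b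
  obtain ⟨r2, -⟩ := resp_insert_insert hR.covers hu hvu hR.mem_a hR.mem_c
  obtain ⟨r3, -⟩ := resp_insert_insert hR.covers hu hvu hR.mem_b hR.mem_c
  obtain ⟨r4, -⟩ := resp_insert_insert hR.covers hu hvu hR.mem_c hR.mem_c
  have h1 := harm_mul_sum hR (Reachable.refl u)
  have h1' := harm_mul_sum hR (Reachable.refl v)
  have h2 := harm_mul_sum hR huv.reachable
  have h2' := harm_mul_sum hR huv.symm.reachable
  have h3 : resp G R c c = -(resp G R a c + resp G R b c) := by
    have := neg_resp_self hR; linarith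
  rw [hB hR.mem_a hR.mem_c hR.ac, hB hR.mem_b hR.mem_c hR.bc, hB hR.mem_a hR.mem_b hR.ab, hL,
    r1, r2, r3, r4, hN, h3]
  unfold minor
  obtain ⟨Δ, hΔ⟩ : ∃ Δ, Δ = green G R u u * green G R v v - green G R u v ^ 2 := ⟨_, rfl⟩
  rw [← hΔ] at hpos ⊢
  have hne := hpos.ne'
  generalize green G R u u = p at *
  generalize green G R v v = q at *
  generalize green G R u v = r at *
  generalize harm G R a u = au at *
  generalize harm G R b u = bu at *
  generalize harm G R c u = cu at *
  generalize harm G R a v = av at *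
  generalize harm G R b v = bv at *
  generalize harm G R c v = cv at *
  generalize resp G R a b = x at *
  generalize resp G R a c = y at *
  generalize resp G R b c = z at *
  obtain ⟨Pab, hab⟩ : ∃ P, P = au * bu * q + av * bv * p - (au * bv + av * bu) * r := ⟨_, rfl⟩
  obtain ⟨Pac, hac⟩ : ∃ P, P = au * cu * q + av * cv * p - (au * cv + av * cu) * r := ⟨_, rfl⟩
  obtain ⟨Pbc, hbc⟩ : ∃ P, P = bu * cu * q + bv * cv * p - (bu * cv + bv * cu) * r := ⟨_, rfl⟩
  obtain ⟨Pcc, hcc⟩ : ∃ P, P = cu * cu * q + cv * cv * p - (cu * cv + cv * cu) * r := ⟨_, rfl⟩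
  rw [← hab, ← hac, ← hbc, ← hcc]
  -- the Cauchy-Binet formula
  have hP : Pac * Pbc - Pcc * Pab =
      -(Δ * ((au * cv - cu * av) * (bu * cv - cu * bv))) := by
    rw [hab, hac, hbc, hcc, hΔ]; ring
  have hS : Pac + Pbc + Pcc = cu * q + cv * p - (cu + cv) * r := by
    rw [hac, hbc, hcc]
    linear_combination q * h1 + p * h1' - r * h2 - r * h2'
  rw [← hS]
  field_simp
  linear_combination rootedCount G R * hP

open scoped Classical in
lemma ite_contribution (hR : IsRootSystem G R a b c) {u v : V} (hu : u ∉ R) (hv : v ∉ R) :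
    (resp G R a b * resp G R a c + resp G R a b * resp G R b c + resp G R a c * resp G R b c) *
        (if G.Adj u v then rootedCount G (insert v (insert u R)) else 0) +
      (if G.Adj u v then rootedCountReach G (insert v (insert u ((R.erase a).erase c))) a b
        else 0) -
      (resp G R a b * ((if G.Adj u v then
            rootedCountReach G (insert v (insert u (R.erase a))) a c else 0) +
          if G.Adj u v then rootedCountReach G (insert v (insert u (R.erase b))) b c else 0) +
        resp G R a c * ((if G.Adj u v then
            rootedCountReach G (insert v (insert u (R.erase a))) a b else 0) +
          if G.Adj u v then rootedCountReach G (insert v (insert u (R.erase b))) b c else 0) +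
        resp G R b c * ((if G.Adj u v then
            rootedCountReach G (insert v (insert u (R.erase a))) a b else 0) +
          if G.Adj u v then rootedCountReach G (insert v (insert u (R.erase a))) a c else 0)) =
    rootedCount G R * (resp G R a b * (if G.Adj u v then
        harm G R c u * green G R v v + harm G R c v * green G R u u -
          (harm G R c u + harm G R c v) * green G R u v else 0) -
      if G.Adj u v then minor G R a c u v * minor G R b c u v else 0) := by
  by_cases h : G.Adj u v
  · simp only [if_pos h]
    exact edge_contribution hR hu hv h
  · simp only [if_neg h]
    ring

open scoped Classical in
/-- The parts of the contributions that are multiples of the effective conductance between `a` and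
`b` cancel, because the function `harm G R c` is harmonic. -/
lemma sum_harm_eq (hR : IsRootSystem G R a b c) :
    ∑ v ∈ Rᶜ, harm G R c v - (1 / 2) * ∑ u ∈ Rᶜ, ∑ v ∈ Rᶜ, (if G.Adj u v then
        harm G R c u * green G R v v + harm G R c v * green G R u u -
          (harm G R c u + harm G R c v) * green G R u v else 0) -
      ∑ v ∈ Rᶜ, (if G.Adj c v then green G R v v else 0) = 0 := by
  have e1 : ∀ v ∈ Rᶜ, ∑ u ∈ Rᶜ, (if G.Adj v u then
      harm G R c u * green G R v v - harm G R c v * green G R v u else 0) =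
      harm G R c v - if G.Adj c v then green G R v v else 0 := by
    intro v hv
    rw [mem_compl] at hv
    have h1 : ∑ u, (if G.Adj v u then
        harm G R c u * green G R v v - harm G R c v * green G R v u else 0) =
        -green G R v v * lap G (harm G R c) v + harm G R c v * lap G (green G R v) v := by
      simp only [lap, mul_sum]
      rw [← sum_add_distrib]
      refine sum_congr rfl fun u _ => ?_
      split_ifs <;> ring
    rw [lap_harm hR.mem_c hv, lap_green_self hR.covers hv] at h1
    have h2 : ∑ u ∈ R, (if G.Adj v u then
        harm G R c u * green G R v v - harm G R c v * green G R v u else 0) =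
        if G.Adj c v then green G R v v else 0 := by
      rw [sum_eq_single_of_mem c hR.mem_c]
      · rw [harm_self hR.covers, green_of_mem hv hR.mem_c, G.adj_comm]
        simp
      · intro u hu huc
        rw [harm_of_ne hR.mem_c hu huc, green_of_mem hv hu]
        simp
    rw [← sum_add_sum_compl R, h2] at h1
    linarith
  have e2 : ∑ u ∈ Rᶜ, ∑ v ∈ Rᶜ, (if G.Adj u v then
        harm G R c u * green G R v v + harm G R c v * green G R u u -
          (harm G R c u + harm G R c v) * green G R u v else 0) =
      2 * ∑ v ∈ Rᶜ, ∑ u ∈ Rᶜ, (if G.Adj v u then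
      harm G R c u * green G R v v - harm G R c v * green G R v u else 0) := by
    rw [two_mul]
    nth_rewrite 2 [sum_comm]
    rw [← sum_add_distrib]
    refine sum_congr rfl fun u hu => ?_
    rw [← sum_add_distrib]
    refine sum_congr rfl fun v hv => ?_
    rw [G.adj_comm v u, green_comm hR.covers (mem_compl.1 hv) (mem_compl.1 hu)]
    split_ifs <;> ring
  rw [e2, sum_congr rfl e1, sum_sub_distrib]
  ring

open scoped Classical in
/-- In `rho`, the edges with both ends among the roots contribute nothing. -/
lemma rho_eq (hR : IsRootSystem G R a b c) : rho G R a b c =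
    (1 / 2) * ∑ u ∈ Rᶜ, ∑ v ∈ Rᶜ, (if G.Adj u v then
        minor G R a c u v * minor G R b c u v else 0) +
      ∑ v ∈ Rᶜ, (if G.Adj c v then harm G R a v * harm G R b v else 0) := by
  have e1 : ∀ u v, v ∈ R → minor G R a c u v * minor G R b c u v =
      if v = c then harm G R a u * harm G R b u else 0 := by
    intro u v hv
    unfold minor
    by_cases hvc : v = c
    · subst hvc
      rw [harm_self hR.covers, harm_of_ne hR.mem_a hv hR.ac.symm,
        harm_of_ne hR.mem_b hv hR.bc.symm, if_pos rfl]
      ring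
    · rw [harm_of_ne hR.mem_c hv hvc, if_neg hvc]
      by_cases hva : v = a
      · subst hva; rw [harm_of_ne hR.mem_b hv hR.ab]; ring
      · rw [harm_of_ne hR.mem_a hv hva]; ring
  have e2 : ∀ u, ∑ v ∈ R, (if G.Adj u v then minor G R a c u v * minor G R b c u v else 0) =
      if G.Adj u c then harm G R a u * harm G R b u else 0 := by
    intro u
    rw [sum_eq_single_of_mem c hR.mem_c]
    · rw [e1 u c hR.mem_c, if_pos rfl]
    · intro v hv hvc
      rw [e1 u v hv, if_neg hvc, ite_self]
  have e3 : ∀ u v, minor G R a c u v * minor G R b c u v =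
      minor G R a c v u * minor G R b c v u := by
    intro u v; unfold minor; ring
  have e4 : ∑ u ∈ R, ∑ v, (if G.Adj u v then minor G R a c u v * minor G R b c u v else 0) =
      ∑ v ∈ Rᶜ, (if G.Adj c v then harm G R a v * harm G R b v else 0) := by
    rw [sum_comm]
    have : ∀ v, ∑ u ∈ R, (if G.Adj u v then minor G R a c u v * minor G R b c u v else 0) =
        if G.Adj c v then harm G R a v * harm G R b v else 0 := by
      intro v
      rw [G.adj_comm c v, ← e2 v]
      refine sum_congr rfl fun u _ => ?_
      rw [G.adj_comm, e3]
    simp only [this]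
    rw [← sum_add_sum_compl R]
    simp only [add_eq_right]
    refine sum_eq_zero fun v hv => ?_
    by_cases hva : v = a
    · subst hva; rw [harm_of_ne hR.mem_b hv hR.ab]; simp
    · rw [harm_of_ne hR.mem_a hv hva]; simp
  have e5 : ∑ u ∈ Rᶜ, ∑ v, (if G.Adj u v then minor G R a c u v * minor G R b c u v else 0) =
      ∑ v ∈ Rᶜ, (if G.Adj c v then harm G R a v * harm G R b v else 0) +
      ∑ u ∈ Rᶜ, ∑ v ∈ Rᶜ, (if G.Adj u v then
        minor G R a c u v * minor G R b c u v else 0) := by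
    rw [← sum_add_distrib]
    refine sum_congr rfl fun u _ => ?_
    rw [← sum_add_sum_compl R, e2, G.adj_comm c u]
  rw [rho, ← sum_add_sum_compl R, e4, e5]
  ring

/-- The leading terms of the two sides of the inequality agree. -/
lemma leading_identity (hR : IsRootSystem G R a b c) :
    rootedCount G R * rootedCountReach G ((R.erase a).erase c) a b =
      rootedCountReach G (R.erase a) a b * rootedCountReach G (R.erase a) a c +
      rootedCountReach G (R.erase a) a b * rootedCountReach G (R.erase b) b c +
      rootedCountReach G (R.erase a) a c * rootedCountReach G (R.erase b) b c := by
  have hL := counts_erase_erase hR ∅ (by simp)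
  rw [empty_union, empty_union] at hL
  have hB : ∀ {i j}, i ∈ R → j ∈ R → i ≠ j →
      rootedCountReach G (R.erase i) i j = rootedCount G R * resp G R i j := by
    intro i j hi hj hij
    have h1 : insert i (R.erase i) = R := insert_erase hi
    rw [rootedCountReach_erase (by simp) (by simp [hij.symm, hj]) (h1.symm ▸ hR.covers), h1]
  have h2 := neg_resp_self hR
  rw [hL, hB hR.mem_a hR.mem_b hR.ab, hB hR.mem_a hR.mem_c hR.ac, hB hR.mem_b hR.mem_c hR.bc]
  linear_combination rootedCount G R ^ 2 * resp G R a b * h2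

/-- The term of first order: on the left, the polarization of `A C - e₂(B)` at the numbers of
forests without and with a free component. In the number of forests that connect `a`, `b` and `c`
and have a free component, the forests whose free component contains `c` are subtracted. -/
theorem first_order_identity (hR : IsRootSystem G R a b c) :
    rootedCountReach G ((R.erase a).erase c) a b * freeCount G R b b +
      (freeCount G ((R.erase a).erase c) a b - rootedCountReach G (R.erase a) a b) *
        rootedCount G R -
      (rootedCountReach G (R.erase a) a b * (freeCount G (R.erase a) a c +
          freeCount G (R.erase b) b c) +
        rootedCountReach G (R.erase a) a c * (freeCount G (R.erase a) a b +
          freeCount G (R.erase b) b c) +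
        rootedCountReach G (R.erase b) b c * (freeCount G (R.erase a) a b +
          freeCount G (R.erase a) a c)) =
    rootedCount G R ^ 2 * rho G R a b c := by
  classical
  have hL := counts_erase_erase hR ∅ (by simp)
  rw [empty_union, empty_union] at hL
  have hB : ∀ {i j}, i ∈ R → j ∈ R → i ≠ j →
      rootedCountReach G (R.erase i) i j = rootedCount G R * resp G R i j := by
    intro i j hi hj hij
    have h1 : insert i (R.erase i) = R := insert_erase hi
    rw [rootedCountReach_erase (by simp) (by simp [hij.symm, hj]) (h1.symm ▸ hR.covers), h1]
  have h2 : resp G R c c = -(resp G R a c + resp G R b c) := by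
    have := neg_resp_self hR; linarith
  have hc1 : freeCount G R b b = ∑ v ∈ Rᶜ, rootedCount G (insert v R) -
      (1 / 2) * ∑ u ∈ Rᶜ, ∑ v ∈ Rᶜ, if G.Adj u v then
        rootedCount G (insert v (insert u R)) else 0 := by
    rw [freeCount, sum_hasFreeComponent G hR.mem_b]
    simp only [rootedCountReach_self]
  have hb1 : ∀ {i j}, i ∈ R → j ∈ R → i ≠ j → freeCount G (R.erase i) i j =
      ∑ v ∈ Rᶜ, rootedCountReach G (insert v (R.erase i)) i j -
        (1 / 2) * ∑ u ∈ Rᶜ, ∑ v ∈ Rᶜ, if G.Adj u v then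
          rootedCountReach G (insert v (insert u (R.erase i))) i j else 0 := by
    intro i j hi hj hij
    rw [freeCount_eq (by simp) (by simp [hij.symm, hj]), insert_erase hi]
  have ha1 : freeCount G ((R.erase a).erase c) a b - rootedCountReach G (R.erase a) a b =
      ∑ v ∈ Rᶜ, rootedCountReach G (insert v ((R.erase a).erase c)) a b -
        (1 / 2) * ∑ u ∈ Rᶜ, ∑ v ∈ Rᶜ, (if G.Adj u v then
          rootedCountReach G (insert v (insert u ((R.erase a).erase c))) a b else 0) -
        ∑ v ∈ Rᶜ, if G.Adj c v then rootedCountReach G (insert v (R.erase a)) a b else 0 := by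
    have hcompl : (insert a ((R.erase a).erase c))ᶜ = insert c Rᶜ := by
      ext x
      by_cases hxa : x = a
      · subst hxa; simp [hR.ac, hR.mem_a]
      · by_cases hxc : x = c
        · subst hxc; simp [hxa]
        · simp [hxa, hxc]
    have hcn : c ∉ Rᶜ := by simp [hR.mem_c]
    have hcins : insert c ((R.erase a).erase c) = R.erase a :=
      insert_erase (by simp [hR.ac.symm, hR.mem_c])
    rw [freeCount_eq (by simp) (by simp [hR.bc, hR.ab.symm, hR.mem_b]), hcompl, sum_insert hcn,
      sum_insert hcn, sum_insert hcn, hcins]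
    simp only [sum_insert hcn, SimpleGraph.irrefl, if_false, zero_add, sum_add_distrib]
    have : ∀ v ∈ Rᶜ, (if G.Adj v c then
        rootedCountReach G (insert c (insert v ((R.erase a).erase c))) a b else 0) =
        if G.Adj c v then rootedCountReach G (insert v (R.erase a)) a b else 0 := by
      intro v _
      rw [insert_comm, hcins, G.adj_comm]
    rw [sum_congr rfl this]
    ring
  have hV := sum_congr rfl fun v (hv : v ∈ Rᶜ) => vertex_contribution hR (mem_compl.1 hv)
  have hE := sum_congr rfl fun u (hu : u ∈ Rᶜ) => sum_congr rfl fun v (hv : v ∈ Rᶜ) =>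
    ite_contribution hR (mem_compl.1 hu) (mem_compl.1 hv)
  have hC : ∑ v ∈ Rᶜ, (if G.Adj c v then
      rootedCountReach G (insert v (R.erase a)) a b else 0) =
      rootedCount G R * (resp G R a b * ∑ v ∈ Rᶜ, (if G.Adj c v then green G R v v else 0) -
        ∑ v ∈ Rᶜ, (if G.Adj c v then harm G R a v * harm G R b v else 0)) := by
    rw [mul_sum, ← sum_sub_distrib, mul_sum]
    refine sum_congr rfl fun v hv => ?_
    rw [counts_insert hR (mem_compl.1 hv) hR.mem_a hR.mem_b hR.ab]
    split_ifs <;> ring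
  have hH := sum_harm_eq hR
  have hrho := rho_eq hR
  rw [ha1, hL, h2, hB hR.mem_a hR.mem_b hR.ab, hB hR.mem_a hR.mem_c hR.ac,
    hB hR.mem_b hR.mem_c hR.bc]
  simp only [sum_add_distrib, sum_sub_distrib, ← mul_sum] at hV hE
  rw [hc1, hb1 hR.mem_a hR.mem_b hR.ab, hb1 hR.mem_a hR.mem_c hR.ac,
    hb1 hR.mem_b hR.mem_c hR.bc, hC, hrho]
  linear_combination rootedCount G R * hV - (1 / 2) * rootedCount G R * hE +
    rootedCount G R ^ 2 * resp G R a b * hH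

end
end

/-! ### Positivity of the first-order coefficient -/

section

variable {V : Type*}

/-- The vertex `u` is connected to a neighbour of `x` in the graph obtained from `G` by deleting all
edges at the vertices of `T`. For `u ∉ T` this says that the component of `u` in `G - T` has a
neighbour of `x`. -/
def Touches (G : SimpleGraph V) (T : Finset V) (u x : V) : Prop :=
  ∃ w, (G.deleteEdges {e | ∃ t ∈ T, t ∈ e}).Reachable u w ∧ G.Adj w x

lemma touches_adj {G : SimpleGraph V} {T : Finset V} {u v x : V} (hu : u ∉ T) (hv : v ∉ T)
    (h : G.Adj u v) :
    Touches G T u x ↔ Touches G T v x := by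
  have hadj : (G.deleteEdges {e | ∃ t ∈ T, t ∈ e}).Adj u v := by
    rw [deleteEdges_adj]
    refine ⟨h, ?_⟩
    rintro ⟨t, ht, hte⟩
    rcases Sym2.mem_iff.1 hte with rfl | rfl
    · exact hu ht
    · exact hv ht
  exact ⟨fun ⟨w, h1, h2⟩ => ⟨w, hadj.symm.reachable.trans h1, h2⟩,
    fun ⟨w, h1, h2⟩ => ⟨w, hadj.reachable.trans h1, h2⟩⟩

lemma Touches.reachable {G : SimpleGraph V} {T : Finset V} {u x : V} (h : Touches G T u x) :
    G.Reachable u x := by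
  obtain ⟨w, h1, h2⟩ := h
  exact (h1.mono (deleteEdges_le _)).trans h2.reachable

variable [Fintype V] [DecidableEq V] {G : SimpleGraph V} {R : Finset V} {a b c : V}

open scoped Classical in
/-- A form of `rho` with nonnegative terms. The two forms differ by a combination of the Dirichlet
pairings of `h_c` with `h_a h_b h_c`, of `h_a` with `h_b h_c ^ 2` and of `h_b` with `h_a h_c ^ 2`.
Each of these vanishes, because the first function is harmonic off the roots and the second is zero
at them. -/
lemma rho_eq_sum_sq (hR : IsRootSystem G R a b c) : rho G R a b c =
    (1 / 2) * ∑ u, ∑ v, if G.Adj u v then (harm G R c u - harm G R c v) ^ 2 *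
      (harm G R a u * harm G R b u + harm G R a v * harm G R b v +
        (1 / 2) * (harm G R a u * harm G R b v + harm G R a v * harm G R b u)) else 0 := by
  obtain ⟨E, hE⟩ : ∃ E : (V → ℝ) → (V → ℝ) → ℝ, ∀ f g, E f g =
      ∑ u, ∑ v, if G.Adj u v then (f u - f v) * (g u - g v) else 0 := ⟨_, fun _ _ => rfl⟩
  have hz : ∀ (f : V → ℝ) (s : V), s ∈ R → (∀ k ∈ R, f k = 0) → E f (harm G R s) = 0 := by
    intro f s hs hf
    have h := sum_mul_lap G f (harm G R s)
    rw [← hE] at h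
    have h0 : ∑ u, f u * lap G (harm G R s) u = 0 := by
      refine sum_eq_zero fun u _ => ?_
      by_cases hu : u ∈ R
      · rw [hf u hu, zero_mul]
      · rw [lap_harm hs hu, mul_zero]
    linarith
  have hk : ∀ k ∈ R, ∀ s ∈ R, ∀ t ∈ R, s ≠ t → harm G R s k * harm G R t k = 0 := by
    intro k hk s hs t ht hst
    by_cases hks : k = s
    · subst hks; rw [harm_of_ne ht hk hst, mul_zero]
    · rw [harm_of_ne hs hk hks, zero_mul]
  have h1 := hz (fun u => harm G R a u * harm G R b u * harm G R c u) c hR.mem_c (fun k hkR => by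
    simp only [hk k hkR a hR.mem_a b hR.mem_b hR.ab, zero_mul])
  have h2 := hz (fun u => harm G R b u * harm G R c u * harm G R c u) a hR.mem_a (fun k hkR => by
    simp only [hk k hkR b hR.mem_b c hR.mem_c hR.bc, zero_mul])
  have h3 := hz (fun u => harm G R a u * harm G R c u * harm G R c u) b hR.mem_b (fun k hkR => by
    simp only [hk k hkR a hR.mem_a c hR.mem_c hR.ac, zero_mul])
  rw [rho, ← sub_eq_zero, ← mul_sub, mul_eq_zero]
  refine Or.inr ?_
  have key := congrArg₂ (fun x y => 2 * x - (1 / 2) * y) h1 (congrArg₂ (fun x y => x + y) h2 h3)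
  simp only [hE, mul_zero, add_zero, sub_zero] at key
  rw [← neg_eq_zero, ← key]
  simp only [mul_sum, ← sum_add_distrib, ← sum_sub_distrib, ← sum_neg_distrib]
  refine sum_congr rfl fun u _ => sum_congr rfl fun v _ => ?_
  unfold minor
  split_ifs <;> ring

/-- The minimum principle: a harmonic function that vanishes at a vertex and is nonnegative vanishes
at the neighbours of that vertex. -/
lemma harm_eq_zero_of_adj {s u v : V} (hs : s ∈ R) (hu : u ∉ R) (h : harm G R s u = 0)
    (huv : G.Adj u v) : harm G R s v = 0 := by
  classical
  have h1 := lap_harm (G := G) hs hu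
  rw [lap] at h1
  have h2 : ∀ w ∈ (univ : Finset V), 0 ≤ if G.Adj u w then harm G R s w else 0 := by
    intro w _
    split_ifs
    · exact harm_nonneg s w
    · exact le_rfl
  have h3 : ∑ w, (if G.Adj u w then harm G R s w else 0) =
      -∑ w, if G.Adj u w then harm G R s u - harm G R s w else 0 := by
    rw [← sum_neg_distrib]
    refine sum_congr rfl fun w _ => ?_
    rw [h]
    split_ifs <;> ring
  rw [h1, neg_zero] at h3
  have := (sum_eq_zero_iff_of_nonneg h2).1 h3 v (mem_univ _)
  rwa [if_pos huv] at this

/-- By the minimum principle, applied along the path that leads from `u` to `s`. -/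
lemma harm_pos_of_touches (hR : IsRootSystem G R a b c) {u s : V} (hu : u ∉ R) (hs : s ∈ R)
    (h : Touches G {a, b, c} u s) : 0 < harm G R s u := by
  refine lt_of_le_of_ne (harm_nonneg s u) fun h0 => ?_
  obtain ⟨w, ⟨p⟩, hw⟩ := h
  -- a vertex that is connected to `a`, `b`, `c` but is none of them is not a root
  have hroot : ∀ {x y}, G.Adj x y → x ∉ R → y ∉ ({a, b, c} : Finset V) →
      G.Reachable x s → s ∈ ({a, b, c} : Finset V) → y ∉ R := by
    intro x y hxy _ hy hxs hsT hyR
    have hr : G.Reachable y s := hxy.symm.reachable.trans hxs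
    by_cases hys : y = s
    · exact hy (hys ▸ hsT)
    · exact hy (hR.sep y hyR s hs hr hys).1
  have key : ∀ {x y} (p : (G.deleteEdges {e | ∃ t ∈ ({a, b, c} : Finset V), t ∈ e}).Walk x y),
      G.Adj y s → x ∉ R → 0 = harm G R s x → False := by
    intro x y p
    induction p with
    | nil =>
      intro hys hx h0
      have := harm_eq_zero_of_adj hs hx h0.symm hys
      rw [harm_self hR.covers] at this
      exact one_ne_zero this
    | @cons x z y hxz p ih =>
      intro hys hx h0
      rw [deleteEdges_adj] at hxz
      have hz : harm G R s z = 0 := harm_eq_zero_of_adj hs hx h0.symm hxz.1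
      refine ih hys (fun hzR => ?_) hz.symm
      have hzT : z ∉ ({a, b, c} : Finset V) := fun hzT => hxz.2 ⟨z, hzT, by simp⟩
      have hzs : G.Reachable z s := ((Walk.reachable p).mono (deleteEdges_le _)).trans hys.reachable
      by_cases hzs' : z = s
      · subst hzs'
        rw [harm_self hR.covers] at hz
        exact one_ne_zero hz
      · exact hzT (hR.sep z hzR s hs hzs hzs').1
  exact key p hw hu h0

/-- Among the nonnegative terms of `rho`, that of an edge from the touching component to `c` is
positive. -/
theorem rho_pos (hR : IsRootSystem G R a b c) {u : V} (hu : u ∉ R)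
    (ha : Touches G {a, b, c} u a) (hb : Touches G {a, b, c} u b)
    (hc : Touches G {a, b, c} u c) : 0 < rho G R a b c := by
  classical
  obtain ⟨w, hw, hwc⟩ := hc
  -- move from `u` to the neighbour `w` of `c`
  have hmove : ∀ {x y}, (G.deleteEdges {e | ∃ t ∈ ({a, b, c} : Finset V), t ∈ e}).Reachable x y →
      x ∉ ({a, b, c} : Finset V) → y ∉ ({a, b, c} : Finset V) := by
    rintro x y ⟨p⟩ hx
    induction p with
    | nil => exact hx
    | @cons x z y hxz p ih =>
      rw [deleteEdges_adj] at hxz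
      exact ih fun hz => hxz.2 ⟨z, hz, by simp⟩
  have hsub : ∀ {x}, x ∉ R → x ∉ ({a, b, c} : Finset V) := by
    intro x hx h
    simp only [mem_insert, mem_singleton] at h
    rcases h with rfl | rfl | rfl
    · exact hx hR.mem_a
    · exact hx hR.mem_b
    · exact hx hR.mem_c
  have hwT := hmove hw (hsub hu)
  have hwR : w ∉ R := fun h => hwT (hR.sep w h c hR.mem_c hwc.reachable
    (by rintro rfl; exact hwc.ne rfl)).1
  have hwa : Touches G {a, b, c} w a := let ⟨x, h1, h2⟩ := ha; ⟨x, hw.symm.trans h1, h2⟩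
  have hwb : Touches G {a, b, c} w b := let ⟨x, h1, h2⟩ := hb; ⟨x, hw.symm.trans h1, h2⟩
  have pa := harm_pos_of_touches hR hwR hR.mem_a hwa
  have pb := harm_pos_of_touches hR hwR hR.mem_b hwb
  have hlt : harm G R c w < 1 := by
    have h1 := harm_mul_sum hR hwc.symm.reachable
    rw [harm_self hR.covers] at h1
    linarith
  have hnn : ∀ x y, 0 ≤ if G.Adj x y then (harm G R c x - harm G R c y) ^ 2 *
      (harm G R a x * harm G R b x + harm G R a y * harm G R b y +
        (1 / 2) * (harm G R a x * harm G R b y + harm G R a y * harm G R b x)) else 0 := by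
    intro x y
    have := harm_nonneg (G := G) (K := R) a x
    have := harm_nonneg (G := G) (K := R) a y
    have := harm_nonneg (G := G) (K := R) b x
    have := harm_nonneg (G := G) (K := R) b y
    split_ifs
    · positivity
    · exact le_rfl
  rw [rho_eq_sum_sq hR]
  refine mul_pos (by norm_num) ?_
  refine sum_pos' (fun x _ => sum_nonneg fun y _ => hnn x y) ⟨w, mem_univ _, ?_⟩
  refine sum_pos' (fun y _ => hnn w y) ⟨c, mem_univ _, ?_⟩
  rw [if_pos hwc, harm_self hR.covers, harm_of_ne hR.mem_a hR.mem_c hR.ac.symm,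
    harm_of_ne hR.mem_b hR.mem_c hR.bc.symm]
  have : 0 < (harm G R c w - 1) ^ 2 := sq_pos_iff.2 (sub_ne_zero.2 hlt.ne)
  convert mul_pos this (mul_pos pa pb) using 2
  ring

end

/-! ### Expansion in the inverse parameter -/

section

open Filter Topology

variable {V : Type*} [DecidableEq V]

lemma HasFreeComponent.separated {F : SimpleGraph V} {S : Finset V} (h : HasFreeComponent F S) :
    ∀ k ∈ S, ∀ l ∈ S, F.Reachable k l → k = l := by
  obtain ⟨w, -, hr⟩ := h
  exact fun k hk l hl => hr.eq_of_reachable k (mem_insert_of_mem hk) l (mem_insert_of_mem hl)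

variable [Fintype V]

/-- Separated vertices can be completed to a set of roots: a maximal separated set is one. -/
lemma exists_isRooted_superset {F : SimpleGraph V} {S : Finset V}
    (hS : ∀ k ∈ S, ∀ l ∈ S, F.Reachable k l → k = l) : ∃ T, S ⊆ T ∧ IsRooted F T := by
  classical
  let P : Finset (Finset V) := univ.filter fun T => S ⊆ T ∧
    ∀ k ∈ T, ∀ l ∈ T, F.Reachable k l → k = l
  have hP : P.Nonempty := ⟨S, mem_filter.2 ⟨mem_univ _, subset_rfl, hS⟩⟩
  obtain ⟨T, hT, hmax⟩ := P.exists_maximal hP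
  simp only [P, mem_filter, mem_univ, true_and] at hT
  refine ⟨T, hT.1, ⟨fun v => ?_, hT.2⟩⟩
  by_contra hv
  push Not at hv
  have hmem : insert v T ∈ P := by
    simp only [P, mem_filter, mem_univ, true_and]
    refine ⟨hT.1.trans (subset_insert _ _), fun k hk l hl hkl => ?_⟩
    rcases mem_insert.1 hk with rfl | hk'
    · rcases mem_insert.1 hl with rfl | hl'
      · rfl
      · exact absurd hkl (hv l hl')
    · rcases mem_insert.1 hl with rfl | hl'
      · exact absurd hkl.symm (hv k hk')
      · exact hT.2 k hk' l hl' hkl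
  exact hv v (hmax hmem (subset_insert _ _) (mem_insert_self _ _)) (Reachable.refl v)

/-- The number of components of the forest `F` that contain no vertex of `S`, if the vertices of `S`
lie in distinct components; written through the number of edges. -/
noncomputable def excess (F : SimpleGraph V) (S : Finset V) : ℕ :=
  Fintype.card V - #S - F.edgeSet.ncard

lemma ncard_edgeSet_add_excess {F : SimpleGraph V} {S : Finset V} (ha : F.IsAcyclic)
    (hS : ∀ k ∈ S, ∀ l ∈ S, F.Reachable k l → k = l) :
    F.edgeSet.ncard + excess F S = Fintype.card V - #S := by
  obtain ⟨T, hST, hT⟩ := exists_isRooted_superset hS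
  have h1 := hT.ncard_edgeSet_add_card ha
  have h2 := card_le_card hST
  unfold excess
  omega

lemma excess_eq_zero_iff {F : SimpleGraph V} {S : Finset V} (ha : F.IsAcyclic)
    (hS : ∀ k ∈ S, ∀ l ∈ S, F.Reachable k l → k = l) : excess F S = 0 ↔ IsRooted F S := by
  constructor
  · intro h
    obtain ⟨T, hST, hT⟩ := exists_isRooted_superset hS
    have h1 := hT.ncard_edgeSet_add_card ha
    unfold excess at h
    have : S = T := eq_of_subset_of_card_le hST (by omega)
    exact this ▸ hT
  · intro h
    have h1 := h.ncard_edgeSet_add_card ha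
    unfold excess
    omega

lemma excess_eq_one_iff {F : SimpleGraph V} {S : Finset V} (ha : F.IsAcyclic)
    (hS : ∀ k ∈ S, ∀ l ∈ S, F.Reachable k l → k = l) : excess F S = 1 ↔ HasFreeComponent F S := by
  constructor
  · intro h
    obtain ⟨T, hST, hT⟩ := exists_isRooted_superset hS
    have h1 := hT.ncard_edgeSet_add_card ha
    have h2 := card_le_card hST
    unfold excess at h
    have h3 : #(T \ S) = 1 := by
      rw [card_sdiff_of_subset hST]; omega
    obtain ⟨w, hw⟩ := card_eq_one.1 h3
    have hwm : w ∈ T \ S := by rw [hw]; exact mem_singleton_self w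
    refine ⟨w, (mem_sdiff.1 hwm).2, ?_⟩
    rwa [insert_eq, ← hw, sdiff_union_of_subset hST]
  · rintro ⟨w, hw, h⟩
    have h1 := h.ncard_edgeSet_add_card ha
    rw [card_insert_of_notMem hw] at h1
    unfold excess
    omega

open scoped Classical in
/-- The generating function of the forests in the event `A`, in powers of the inverse parameter and
normalized by the largest possible power of the parameter. -/
noncomputable def excessSum (G : SimpleGraph V) (S : Finset V) (A : SimpleGraph V → Prop) (t : ℝ) :
    ℝ :=
  ∑ F ∈ (forests G).filter A, t ^ excess F S

section
variable {G : SimpleGraph V} {S : Finset V} {A : SimpleGraph V → Prop}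

open scoped Classical in
lemma sum_weight_eq (hA : ∀ F ∈ forests G, A F → ∀ k ∈ S, ∀ l ∈ S, F.Reachable k l → k = l)
    {lam : ℝ} (hl : lam ≠ 0) : ∑ F ∈ (forests G).filter A, weight lam F =
      lam ^ (Fintype.card V - #S) * excessSum G S A lam⁻¹ := by
  rw [excessSum, mul_sum]
  refine sum_congr rfl fun F hF => ?_
  rw [mem_filter] at hF
  rw [weight, ← ncard_edgeSet_add_excess (mem_forests.1 hF.1).2 (hA F hF.1 hF.2), pow_add, inv_pow,
    mul_assoc, mul_inv_cancel₀ (pow_ne_zero _ hl), mul_one]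

open scoped Classical in
lemma excessSum_zero (hA : ∀ F ∈ forests G, A F → ∀ k ∈ S, ∀ l ∈ S, F.Reachable k l → k = l) :
    excessSum G S A 0 = ∑ F ∈ forests G, if IsRooted F S ∧ A F then (1 : ℝ) else 0 := by
  rw [excessSum, sum_filter]
  refine sum_congr rfl fun F hF => ?_
  by_cases h : A F
  · have := excess_eq_zero_iff (mem_forests.1 hF).2 (hA F hF h)
    by_cases h0 : excess F S = 0
    · simp [h, h0, this.1 h0]
    · simp [h, h0, mt this.2 h0]
  · simp [h]

open scoped Classical in
/-- The coefficient of first order counts the forests with exactly one free component. -/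
lemma hasDerivAt_excessSum
    (hA : ∀ F ∈ forests G, A F → ∀ k ∈ S, ∀ l ∈ S, F.Reachable k l → k = l) :
    HasDerivAt (excessSum G S A)
      (∑ F ∈ forests G, if HasFreeComponent F S ∧ A F then (1 : ℝ) else 0) 0 := by
  have h1 : HasDerivAt (excessSum G S A) (∑ F ∈ (forests G).filter A,
      ((excess F S : ℕ) : ℝ) * (0 : ℝ) ^ (excess F S - 1)) 0 := by
    have := HasDerivAt.fun_sum (u := (forests G).filter A)
      (A := fun F (t : ℝ) => t ^ excess F S) (x := (0 : ℝ))
      (A' := fun F => ((excess F S : ℕ) : ℝ) * (0 : ℝ) ^ (excess F S - 1))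
      (fun F _ => hasDerivAt_pow (excess F S) 0)
    exact this
  convert h1 using 1
  rw [sum_filter]
  refine sum_congr rfl fun F hF => ?_
  by_cases h : A F
  · have := excess_eq_one_iff (mem_forests.1 hF).2 (hA F hF h)
    rw [if_pos h]
    by_cases h0 : excess F S = 1
    · simp [h, h0, this.1 h0]
    · rw [if_neg (fun hh => h0 (this.2 hh.1))]
      rcases Nat.lt_or_gt_of_ne h0 with h2 | h2
      · simp [Nat.lt_one_iff.1 h2]
      · rw [zero_pow (by omega), mul_zero]
  · simp [h]

end

lemma sum_isRooted_eq (G : SimpleGraph V) (S : Finset V) (A : SimpleGraph V → Prop) (x s : V)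
    (h : ∀ F ∈ forests G, IsRooted F S → (A F ↔ F.Reachable x s)) :
    (open scoped Classical in ∑ F ∈ forests G, if IsRooted F S ∧ A F then (1 : ℝ) else 0) =
      rootedCountReach G S x s := by
  classical
  rw [rootedCountReach, rootedForests, sum_filter]
  refine sum_congr rfl fun F hF => ?_
  by_cases h1 : IsRooted F S
  · have := h F hF h1
    by_cases h2 : F.Reachable x s
    · simp [h1, h2, this.2 h2]
    · simp [h1, h2, mt this.1 h2]
  · simp [h1]

lemma sum_hasFreeComponent_eq (G : SimpleGraph V) (S : Finset V) (A : SimpleGraph V → Prop)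
    (x s : V) (h : ∀ F ∈ forests G, HasFreeComponent F S → (A F ↔ F.Reachable x s)) :
    (open scoped Classical in ∑ F ∈ forests G, if HasFreeComponent F S ∧ A F then (1 : ℝ) else 0) =
      freeCount G S x s := by
  classical
  rw [freeCount]
  refine sum_congr rfl fun F hF => ?_
  by_cases h1 : HasFreeComponent F S
  · have := h F hF h1
    by_cases h2 : F.Reachable x s
    · simp [h1, h2, this.2 h2]
    · simp [h1, h2, mt this.1 h2]
  · simp [h1]

/-- A function that vanishes to first order at `0` with positive slope, evaluated at the inverse
parameter. -/
lemma eventually_nonneg_and_isLittleO {q d Q D s : ℝ → ℝ} {q' : ℝ} (h0 : q 0 = 0)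
    (hq : HasDerivAt q q' 0) (hpos : 0 < q') (hd : ContinuousAt d 0) (hd0 : d 0 ≠ 0)
    (hs : ∀ lam, 0 < lam → 0 < s lam) (hQ : ∀ lam, 0 < lam → Q lam = s lam * q lam⁻¹)
    (hD : ∀ lam, 0 < lam → D lam = s lam * d lam⁻¹) :
    (∀ᶠ lam in atTop, 0 ≤ Q lam) ∧ Q =o[atTop] D := by
  have hinv : Tendsto (fun lam : ℝ => lam⁻¹) atTop (𝓝[>] 0) := tendsto_inv_atTop_nhdsGT_zero
  have hev : ∀ᶠ t in 𝓝[>] (0 : ℝ), 0 < q t := by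
    have h1 := (hasDerivAt_iff_tendsto_slope.1 hq).mono_left
      (nhdsWithin_mono 0 (s := Set.Ioi 0) (fun x hx => ne_of_gt hx))
    filter_upwards [h1.eventually (lt_mem_nhds hpos), self_mem_nhdsWithin] with t ht ht0
    rw [slope_def_field, h0, sub_zero, sub_zero] at ht
    have ht0 : 0 < t := ht0
    have := mul_pos ht ht0
    rwa [div_mul_cancel₀ _ ht0.ne'] at this
  constructor
  · filter_upwards [hinv.eventually hev, eventually_gt_atTop 0] with lam h1 h2
    rw [hQ lam h2]
    exact (mul_pos (hs lam h2) h1).le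
  · have hlim : (fun lam : ℝ => q lam⁻¹) =o[atTop] fun lam : ℝ => d lam⁻¹ := by
      have h1 : q =o[𝓝 0] d := by
        have h2 : q =o[𝓝 0] fun _ => (1 : ℝ) := by
          rw [Asymptotics.isLittleO_one_iff]
          have := hq.continuousAt.tendsto
          rwa [h0] at this
        refine h2.trans_isBigO ?_
        rw [Asymptotics.isBigO_const_left_iff_pos_le_norm one_ne_zero]
        have hn : 0 < ‖d 0‖ := norm_pos_iff.2 hd0
        refine ⟨‖d 0‖ / 2, half_pos hn, ?_⟩
        filter_upwards [hd.norm.tendsto.eventually (lt_mem_nhds (half_lt_self hn))] with t ht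
        exact ht.le
      exact h1.comp_tendsto (hinv.mono_right nhdsWithin_le_nhds)
    have h3 := (Asymptotics.isBigO_refl s atTop).mul_isLittleO hlim
    refine h3.congr' ?_ ?_
    · filter_upwards [eventually_gt_atTop 0] with lam h using (hQ lam h).symm
    · filter_upwards [eventually_gt_atTop 0] with lam h using (hD lam h).symm

end

/-! ### The inequality when some component touches all three vertices -/

section

open Filter Topology

variable {V : Type*} [Fintype V]

/-- The root system consists of `a`, `b`, `c` and a representative of each other component. -/
lemma exists_isRootSystem [DecidableEq V] {G : SimpleGraph V} {a b c : V} (hab : a ≠ b)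
    (hac : a ≠ c) (hbc : b ≠ c) (h1 : G.Reachable a b) (h2 : G.Reachable a c) :
    ∃ R : Finset V, IsRootSystem G R a b c ∧
      ∀ v, v ∉ ({a, b, c} : Finset V) → G.Reachable a v → v ∉ R := by
  classical
  have hT : ∀ v ∈ ({a, b, c} : Finset V), G.Reachable a v := by
    intro v hv
    simp only [mem_insert, mem_singleton] at hv
    rcases hv with rfl | rfl | rfl
    · exact Reachable.refl _
    · exact h1
    · exact h2
  refine ⟨univ.filter fun v => v ∈ ({a, b, c} : Finset V) ∨
    (¬ G.Reachable a v ∧ (G.connectedComponentMk v).out = v), ?_, ?_⟩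
  · refine ⟨by simp, by simp, by simp, hab, hac, hbc, fun v => ?_, h1, h2, ?_⟩
    · by_cases hv : G.Reachable a v
      · exact ⟨a, by simp, hv.symm⟩
      · have hout : G.connectedComponentMk (G.connectedComponentMk v).out =
            G.connectedComponentMk v := Quot.out_eq _
        have hr : G.Reachable (G.connectedComponentMk v).out v := ConnectedComponent.exact hout
        refine ⟨(G.connectedComponentMk v).out, ?_, hr.symm⟩
        simp only [mem_filter, mem_univ, true_and]
        exact Or.inr ⟨fun h => hv (h.trans hr), by rw [hout]⟩
    · intro k hk l hl hkl hne
      simp only [mem_filter, mem_univ, true_and] at hk hl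
      rcases hk with hk | ⟨hk1, hk2⟩
      · rcases hl with hl | ⟨hl1, hl2⟩
        · exact ⟨hk, hl⟩
        · exact absurd ((hT k hk).trans hkl) hl1
      · rcases hl with hl | ⟨hl1, hl2⟩
        · exact absurd ((hT l hl).trans hkl.symm) hk1
        · refine absurd ?_ hne
          rw [← hk2, ← hl2, ConnectedComponent.sound hkl]
  · intro v hv hav hvR
    simp only [mem_filter, mem_univ, true_and] at hvR
    rcases hvR with h | ⟨h, -⟩
    · exact hv h
    · exact h hav

/-- The amount by which the inequality in terms of `e2` holds. -/
noncomputable def gap (G : SimpleGraph V) (a b c : V) (lam : ℝ) : ℝ :=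
  probSeparate G lam a b c * probTogether G lam a b c -
    e2 (probPairSplit G lam b c a) (probPairSplit G lam a b c) (probPairSplit G lam a c b)

lemma partitionFunction_pos (G : SimpleGraph V) {lam : ℝ} (h : 0 < lam) :
    0 < partitionFunction G lam := by
  refine sum_pos (fun F _ => pow_pos h _) ⟨⊥, mem_forests.2 ⟨bot_le, isAcyclic_bot⟩⟩

/-- The gap is, up to a positive factor, a polynomial in `lam⁻¹` that vanishes at `0` by
`leading_identity` and has the positive derivative of `first_order_identity` there. -/
theorem gap_of_touches [DecidableEq V] {G : SimpleGraph V} {R : Finset V} {a b c u : V}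
    (hR : IsRootSystem G R a b c) (hu : u ∉ R) (ha : Touches G {a, b, c} u a)
    (hb : Touches G {a, b, c} u b) (hc : Touches G {a, b, c} u c) :
    (∀ᶠ lam in atTop, 0 ≤ gap G a b c lam) ∧ gap G a b c =o[atTop]
      fun lam => probSeparate G lam a b c * probTogether G lam a b c := by
  classical
  have hGF : ∀ {F x y}, F ∈ forests G → F.Reachable x y → G.Reachable x y := fun hF h =>
    h.mono (mem_forests.1 hF).1
  have hT : ∀ {x}, x ∈ ({a, b, c} : Finset V) → x = a ∨ x = b ∨ x = c := by simp
  -- separation of the roots, for the three kinds of events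
  have sepC : ∀ F ∈ forests G, (¬ F.Reachable a b ∧ ¬ F.Reachable a c ∧ ¬ F.Reachable b c) →
      ∀ k ∈ R, ∀ l ∈ R, F.Reachable k l → k = l := by
    rintro F hF ⟨h1, h2, h3⟩ k hk l hl hkl
    by_contra hne
    obtain ⟨m1, m2⟩ := hR.sep k hk l hl (hGF hF hkl) hne
    rcases hT m1 with rfl | rfl | rfl <;> rcases hT m2 with rfl | rfl | rfl
    · exact hne rfl
    · exact h1 hkl
    · exact h2 hkl
    · exact h1 hkl.symm
    · exact hne rfl
    · exact h3 hkl
    · exact h2 hkl.symm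
    · exact h3 hkl.symm
    · exact hne rfl
  have sepB : ∀ i j k, ({a, b, c} : Finset V) = {i, j, k} → ∀ F ∈ forests G,
      (F.Reachable i j ∧ ¬ F.Reachable i k ∧ ¬ F.Reachable j k) →
      ∀ x ∈ R.erase i, ∀ y ∈ R.erase i, F.Reachable x y → x = y := by
    rintro i j k hijk F hF ⟨h1, h2, h3⟩ x hx y hy hxy
    by_contra hne
    rw [mem_erase] at hx hy
    obtain ⟨m1, m2⟩ := hR.sep x hx.2 y hy.2 (hGF hF hxy) hne
    rw [hijk] at m1 m2
    simp only [mem_insert, mem_singleton] at m1 m2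
    rcases m1.resolve_left hx.1 with rfl | rfl <;> rcases m2.resolve_left hy.1 with rfl | rfl
    · exact hne rfl
    · exact h3 hxy
    · exact h3 hxy.symm
    · exact hne rfl
  have rootA : ∀ {F x}, F ∈ forests G → x ∈ (R.erase a).erase c → F.Reachable b x → b = x := by
    intro F x hF hx hbx
    by_contra hne
    simp only [mem_erase] at hx
    obtain ⟨-, m2⟩ := hR.sep b hR.mem_b x hx.2.2 (hGF hF hbx) hne
    rcases hT m2 with h | h | h
    · exact hx.2.1 h
    · exact hne h.symm
    · exact hx.1 h
  have rootA' : ∀ {F x}, F ∈ forests G → x ∈ (R.erase a).erase c → F.Reachable c x → b = x := by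
    intro F x hF hx hcx
    simp only [mem_erase] at hx
    obtain ⟨-, m2⟩ := hR.sep c hR.mem_c x hx.2.2 (hGF hF hcx) (Ne.symm hx.1)
    rcases hT m2 with h | h | h
    · exact absurd h hx.2.1
    · exact h.symm
    · exact absurd h hx.1
  have sepA : ∀ F ∈ forests G, (F.Reachable a b ∧ F.Reachable a c ∧ F.Reachable b c) →
      ∀ x ∈ (R.erase a).erase c, ∀ y ∈ (R.erase a).erase c, F.Reachable x y → x = y := by
    rintro F hF - x hx y hy hxy
    by_contra hne
    simp only [mem_erase] at hx hy
    obtain ⟨m1, m2⟩ := hR.sep x hx.2.2 y hy.2.2 (hGF hF hxy) hne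
    have e1 : x = b := by
      rcases hT m1 with h | h | h
      · exact absurd h hx.2.1
      · exact h
      · exact absurd h hx.1
    have e2 : y = b := by
      rcases hT m2 with h | h | h
      · exact absurd h hy.2.1
      · exact h
      · exact absurd h hy.1
    exact hne (e1.trans e2.symm)
  have bA : b ∈ (R.erase a).erase c := by simp [hR.bc, hR.ab.symm, hR.mem_b]
  -- values and derivatives at `0` of the generating functions
  have vC : excessSum G R (fun F => ¬ F.Reachable a b ∧ ¬ F.Reachable a c ∧ ¬ F.Reachable b c) 0 =
      rootedCount G R := by
    rw [excessSum_zero sepC, sum_isRooted_eq G R _ b b, rootedCountReach_self]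
    intro F _ hr
    refine ⟨fun _ => Reachable.refl _, fun _ => ⟨fun h => ?_, fun h => ?_, fun h => ?_⟩⟩
    · exact hR.ab (hr.eq_of_reachable _ hR.mem_a _ hR.mem_b h)
    · exact hR.ac (hr.eq_of_reachable _ hR.mem_a _ hR.mem_c h)
    · exact hR.bc (hr.eq_of_reachable _ hR.mem_b _ hR.mem_c h)
  have dC := hasDerivAt_excessSum sepC
  rw [sum_hasFreeComponent_eq G R _ b b (fun F _ hr =>
    ⟨fun _ => Reachable.refl _, fun _ =>
      ⟨fun h => hR.ab (hr.separated _ hR.mem_a _ hR.mem_b h),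
      fun h => hR.ac (hr.separated _ hR.mem_a _ hR.mem_c h),
      fun h => hR.bc (hr.separated _ hR.mem_b _ hR.mem_c h)⟩⟩)] at dC
  have pairB : ∀ i j k, ({a, b, c} : Finset V) = {i, j, k} → i ≠ j → i ≠ k → j ≠ k → j ∈ R →
      k ∈ R → excessSum G (R.erase i)
          (fun F => F.Reachable i j ∧ ¬ F.Reachable i k ∧ ¬ F.Reachable j k) 0 =
        rootedCountReach G (R.erase i) i j ∧
      HasDerivAt (excessSum G (R.erase i)
          (fun F => F.Reachable i j ∧ ¬ F.Reachable i k ∧ ¬ F.Reachable j k))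
        (freeCount G (R.erase i) i j) 0 := by
    intro i j k hijk hij hik hjk hj hk
    have mj : j ∈ R.erase i := by simp [hj, hij.symm]
    have mk : k ∈ R.erase i := by simp [hk, hik.symm]
    constructor
    · rw [excessSum_zero (sepB i j k hijk), sum_isRooted_eq G _ _ i j]
      intro F _ hr
      refine ⟨fun h => h.1, fun h => ⟨h, fun h' => ?_, fun h' => ?_⟩⟩
      · exact hjk (hr.eq_of_reachable _ mj _ mk (h.symm.trans h'))
      · exact hjk (hr.eq_of_reachable _ mj _ mk h')
    · have h := hasDerivAt_excessSum (sepB i j k hijk)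
      rwa [sum_hasFreeComponent_eq G _ _ i j (fun F _ hr =>
        ⟨fun h => h.1, fun h => ⟨h, fun h' => hjk (hr.separated _ mj _ mk (h.symm.trans h')),
          fun h' => hjk (hr.separated _ mj _ mk h')⟩⟩)] at h
  obtain ⟨vab, dab⟩ := pairB a b c rfl hR.ab hR.ac hR.bc hR.mem_b hR.mem_c
  obtain ⟨vac, dac⟩ := pairB a c b (by ext; simp; tauto) hR.ac hR.ab hR.bc.symm hR.mem_c hR.mem_b
  obtain ⟨vbc, dbc⟩ := pairB b c a (by ext; simp; tauto) hR.bc hR.ab.symm hR.ac.symm hR.mem_c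
    hR.mem_a
  have vA : excessSum G ((R.erase a).erase c)
      (fun F => F.Reachable a b ∧ F.Reachable a c ∧ F.Reachable b c) 0 =
      rootedCountReach G ((R.erase a).erase c) a b := by
    rw [excessSum_zero sepA, sum_isRooted_eq G _ _ a b]
    intro F hF hr
    refine ⟨fun h => h.1, fun h => ?_⟩
    obtain ⟨k, hk, hck⟩ := hr.exists_root c
    have := rootA' hF hk hck
    subst this
    exact ⟨h, h.trans hck.symm, hck.symm⟩
  have dA : HasDerivAt (excessSum G ((R.erase a).erase c)
      (fun F => F.Reachable a b ∧ F.Reachable a c ∧ F.Reachable b c))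
      (freeCount G ((R.erase a).erase c) a b - rootedCountReach G (R.erase a) a b) 0 := by
    have h := hasDerivAt_excessSum sepA
    convert h using 1
    rw [sub_eq_iff_eq_add, freeCount, rootedCountReach, rootedForests, sum_filter,
      ← sum_add_distrib]
    refine sum_congr rfl fun F hF => ?_
    have hcS : c ∉ (R.erase a).erase c := by simp
    have hins : insert c ((R.erase a).erase c) = R.erase a :=
      insert_erase (by simp [hR.ac.symm, hR.mem_c])
    by_cases hab : F.Reachable a b
    · by_cases hf : HasFreeComponent F ((R.erase a).erase c)
      · have hiff : IsRooted F (R.erase a) ↔ ¬ F.Reachable b c := by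
          obtain ⟨w, hw, hr⟩ := hf
          rw [← hins, ← and_iff_right (a := c ∉ (R.erase a).erase c)
            (b := IsRooted F (insert c ((R.erase a).erase c))) hcS, hr.change_root hw]
          constructor
          · intro h1 h2
            have := hr.eq_of_reachable w (mem_insert_self _ _) b (mem_insert_of_mem bA)
              (h1.trans h2.symm)
            exact hw (this ▸ bA)
          · intro h1
            obtain ⟨k, hk, hck⟩ := hr.exists_root c
            rcases mem_insert.1 hk with rfl | hk
            · exact hck.symm
            · have := rootA' hF hk hck
              subst this
              exact absurd hck.symm h1
        by_cases hbc : F.Reachable b c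
        · simp [hab, hf, hiff, hbc, hab.trans hbc]
        · simp [hab, hf, hiff, hbc]
      · have : ¬ IsRooted F (R.erase a) := fun h => hf ⟨c, hcS, by rwa [hins]⟩
        simp [hf, this]
    · simp [hab]
  -- the scaled quantities
  set pC := excessSum G R (fun F => ¬ F.Reachable a b ∧ ¬ F.Reachable a c ∧ ¬ F.Reachable b c)
  set pab := excessSum G (R.erase a)
    (fun F => F.Reachable a b ∧ ¬ F.Reachable a c ∧ ¬ F.Reachable b c)
  set pac := excessSum G (R.erase a)
    (fun F => F.Reachable a c ∧ ¬ F.Reachable a b ∧ ¬ F.Reachable c b)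
  set pbc := excessSum G (R.erase b)
    (fun F => F.Reachable b c ∧ ¬ F.Reachable b a ∧ ¬ F.Reachable c a)
  set pA := excessSum G ((R.erase a).erase c)
    (fun F => F.Reachable a b ∧ F.Reachable a c ∧ F.Reachable b c)
  set m := Fintype.card V - #R with hm
  have hcard : #R ≤ Fintype.card V := card_le_univ R
  have hca : #(R.erase a) + 1 = #R := card_erase_add_one hR.mem_a
  have hcb : #(R.erase b) + 1 = #R := card_erase_add_one hR.mem_b
  have hcc : #((R.erase a).erase c) + 1 = #(R.erase a) :=
    card_erase_add_one (by simp [hR.ac.symm, hR.mem_c])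
  have ma : Fintype.card V - #(R.erase a) = m + 1 := by omega
  have mb : Fintype.card V - #(R.erase b) = m + 1 := by omega
  have mA : Fintype.card V - #((R.erase a).erase c) = m + 2 := by omega
  have wC : ∀ lam, 0 < lam → probSeparate G lam a b c =
      lam ^ m * pC lam⁻¹ / partitionFunction G lam := fun lam hl => by
    rw [probSeparate, prob, sum_weight_eq sepC hl.ne']
  have wab : ∀ lam, 0 < lam → probPairSplit G lam a b c =
      lam ^ (m + 1) * pab lam⁻¹ / partitionFunction G lam := fun lam hl => by
    rw [probPairSplit, prob, sum_weight_eq (sepB a b c rfl) hl.ne', ma]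
  have wac : ∀ lam, 0 < lam → probPairSplit G lam a c b =
      lam ^ (m + 1) * pac lam⁻¹ / partitionFunction G lam := fun lam hl => by
    rw [probPairSplit, prob, sum_weight_eq (sepB a c b (by ext; simp; tauto)) hl.ne', ma]
  have wbc : ∀ lam, 0 < lam → probPairSplit G lam b c a =
      lam ^ (m + 1) * pbc lam⁻¹ / partitionFunction G lam := fun lam hl => by
    rw [probPairSplit, prob, sum_weight_eq (sepB b c a (by ext; simp; tauto)) hl.ne', mb]
  have wA : ∀ lam, 0 < lam → probTogether G lam a b c =
      lam ^ (m + 2) * pA lam⁻¹ / partitionFunction G lam := fun lam hl => by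
    rw [probTogether, prob, sum_weight_eq sepA hl.ne', mA]
  have hN := rootedCount_pos hR.covers
  have hNA : 0 < rootedCountReach G ((R.erase a).erase c) a b := by
    have h1 : rootedCount G ((R.erase a).erase c) =
        rootedCountReach G ((R.erase a).erase c) a b := by
      rw [rootedCount, rootedCountReach]
      refine sum_congr rfl fun F hF => ?_
      rw [mem_rootedForests, ← mem_forests] at hF
      obtain ⟨k, hk, hak⟩ := hF.2.exists_root a
      have : k = b := by
        by_contra hne
        have hk' := hk
        simp only [mem_erase] at hk'
        obtain ⟨-, m2⟩ := hR.sep a hR.mem_a k hk'.2.2 (hGF hF.1 hak) (Ne.symm hk'.2.1)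
        rcases hT m2 with h | h | h
        · exact hk'.2.1 h
        · exact hne h
        · exact hk'.1 h
      rw [if_pos (this ▸ hak)]
    rw [← h1]
    exact rootedCount_pos (covers_erase_erase hR)
  have hq0 := leading_identity hR
  have hq1 := first_order_identity hR
  refine eventually_nonneg_and_isLittleO
    (q := fun t => pC t * pA t - (pbc t * pab t + pbc t * pac t + pab t * pac t))
    (d := fun t => pC t * pA t) (q' := rootedCount G R ^ 2 * rho G R a b c)
    (s := fun lam => lam ^ (2 * m + 2) / partitionFunction G lam ^ 2) ?_ ?_ ?_ ?_ ?_ ?_ ?_ ?_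
  · simp only [vC, vA, vab, vac, vbc]
    linarith
  · have := (dC.mul dA).sub (((dbc.mul dab).add (dbc.mul dac)).add (dab.mul dac))
    refine this.congr_deriv ?_
    rw [vC, vA, vab, vac, vbc, ← hq1]
    ring
  · exact mul_pos (pow_pos hN 2) (rho_pos hR hu ha hb hc)
  · exact dC.continuousAt.mul dA.continuousAt
  · simp only [vC, vA]
    exact (mul_pos hN hNA).ne'
  · intro lam hl
    exact div_pos (pow_pos hl _) (pow_pos (partitionFunction_pos G hl) 2)
  · intro lam hl
    rw [gap, e2, wC lam hl, wA lam hl, wab lam hl, wac lam hl, wbc lam hl]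
    have := (partitionFunction_pos G hl).ne'
    field_simp
    ring
  · intro lam hl
    rw [wC lam hl, wA lam hl]
    have := (partitionFunction_pos G hl).ne'
    field_simp
    ring

end

/-! ### Gluing two graphs at two vertices -/

section

variable {V : Type*}

/-- The graphs `G₁` and `G₂` have no common edge, and no common vertex other than `a` and `b`
(isolated vertices disregarded). -/
structure MeetAt (G₁ G₂ : SimpleGraph V) (a b : V) : Prop where
  /-- A vertex that has edges in both graphs is `a` or `b`. -/
  vert : ∀ x y z, G₁.Adj x y → G₂.Adj x z → x = a ∨ x = b
  /-- The graphs have no common edge. -/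
  edge : ∀ x y, G₁.Adj x y → ¬ G₂.Adj x y

section
variable {F₁ F₂ : SimpleGraph V} {a b : V}

lemma MeetAt.symm (h : MeetAt F₁ F₂ a b) : MeetAt F₂ F₁ a b :=
  ⟨fun x y z h1 h2 => h.vert x z y h2 h1, fun x y h1 h2 => h.edge x y h2 h1⟩

lemma MeetAt.mono {H₁ H₂ : SimpleGraph V} (h : MeetAt F₁ F₂ a b) (h₁ : H₁ ≤ F₁) (h₂ : H₂ ≤ F₂) :
    MeetAt H₁ H₂ a b :=
  ⟨fun x y z k1 k2 => h.vert x y z (h₁ k1) (h₂ k2), fun x y k1 k2 => h.edge x y (h₁ k1) (h₂ k2)⟩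

lemma eq_or_adj_of_reachable {F : SimpleGraph V} {x y : V} (h : F.Reachable x y) :
    x = y ∨ ∃ z, F.Adj y z := by
  obtain ⟨p⟩ := h.symm
  cases p with
  | nil => exact Or.inl rfl
  | cons hadj _ => exact Or.inr ⟨_, hadj⟩

/-- Between vertices of the second graph, the first graph acts like an edge `ab` or like nothing. -/
lemma MeetAt.reachable_sup_iff (h : MeetAt F₁ F₂ a b) {x y : V}
    (hx : ∀ z, F₁.Adj x z → x = a ∨ x = b) (hy : ∀ z, F₁.Adj y z → y = a ∨ y = b) :
    (F₁ ⊔ F₂).Reachable x y ↔ F₂.Reachable x y ∨ (F₁.Reachable a b ∧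
      ((F₂.Reachable x a ∧ F₂.Reachable b y) ∨ (F₂.Reachable x b ∧ F₂.Reachable a y))) := by
  constructor
  · obtain ⟨H, hle, hab, hiff⟩ : ∃ H : SimpleGraph V, F₂ ≤ H ∧
        (F₁.Reachable a b → H.Reachable a b) ∧ ∀ x y, H.Reachable x y ↔ F₂.Reachable x y ∨
        (F₁.Reachable a b ∧
        ((F₂.Reachable x a ∧ F₂.Reachable b y) ∨ (F₂.Reachable x b ∧ F₂.Reachable a y))) := by
      by_cases hab : F₁.Reachable a b
      · refine ⟨F₂ ⊔ SimpleGraph.edge a b, le_sup_left, fun _ => ?_, fun x y => ?_⟩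
        · rw [reachable_sup_edge_iff]
          exact Or.inr (Or.inl ⟨Reachable.refl _, Reachable.refl _⟩)
        · rw [reachable_sup_edge_iff]
          simp [hab]
      · exact ⟨F₂, le_rfl, fun h => absurd h hab, fun x y => by simp [hab]⟩
    have habH : ∀ e z, (e = a ∨ e = b) → (z = a ∨ z = b) → F₁.Reachable e z →
        H.Reachable e z := by
      rintro e z (rfl | rfl) (rfl | rfl) hez
      · exact Reachable.refl _
      · exact hab hez
      · exact (hab hez.symm).symm
      · exact Reachable.refl _
    rw [← hiff]
    rintro ⟨p⟩
    -- the invariant along the walk, for its last vertex `z`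
    have key : ∀ {x z : V} (p : (F₁ ⊔ F₂).Walk z x), (∀ w, F₁.Adj x w → x = a ∨ x = b) →
        (H.Reachable x z ∧ ∀ w, F₁.Adj z w → z = a ∨ z = b) ∨
        ∃ e, (e = a ∨ e = b) ∧ H.Reachable x e ∧ F₁.Reachable e z := by
      intro x z p hx
      induction p with
      | nil => exact Or.inl ⟨Reachable.refl _, hx⟩
      | @cons z' z x hadj p ih =>
        rcases hadj with hadj | hadj
        · rcases ih hx with ⟨h1, h2⟩ | ⟨e, he, h1, h2⟩
          · exact Or.inr ⟨z, h2 _ hadj.symm, h1, hadj.symm.reachable⟩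
          · exact Or.inr ⟨e, he, h1, h2.trans hadj.symm.reachable⟩
        · have hz' : ∀ w, F₁.Adj z' w → z' = a ∨ z' = b := fun w hw => h.vert _ _ _ hw hadj
          refine Or.inl ⟨?_, hz'⟩
          have hstep : H.Reachable z z' := (hle hadj.symm).reachable
          rcases ih hx with ⟨h1, -⟩ | ⟨e, he, h1, h2⟩
          · exact h1.trans hstep
          · rcases eq_or_adj_of_reachable h2 with rfl | ⟨w, hw⟩
            · exact h1.trans hstep
            · exact (h1.trans (habH e z he (h.vert _ _ _ hw hadj.symm) h2)).trans hstep
    rcases key p.reverse hx with ⟨h1, -⟩ | ⟨e, he, h1, h2⟩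
    · exact h1
    · rcases eq_or_adj_of_reachable h2 with rfl | ⟨w, hw⟩
      · exact h1
      · exact h1.trans (habH e y he (hy w hw) h2)
  · have m1 : ∀ {x y}, F₁.Reachable x y → (F₁ ⊔ F₂).Reachable x y := fun h => h.mono le_sup_left
    have m2 : ∀ {x y}, F₂.Reachable x y → (F₁ ⊔ F₂).Reachable x y := fun h => h.mono le_sup_right
    rintro (h1 | ⟨h1, ⟨h2, h3⟩ | ⟨h2, h3⟩⟩)
    · exact m2 h1
    · exact (m2 h2).trans ((m1 h1).trans (m2 h3))
    · exact (m2 h2).trans ((m1 h1).symm.trans (m2 h3))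

/-- A cycle of the glued graph through an edge of the first forest would contain a path from `a` to
`b` in each of the two. -/
lemma MeetAt.isBridge_of_left (h : MeetAt F₁ F₂ a b) (h₁ : F₁.IsAcyclic)
    (hab : ¬ (F₁.Reachable a b ∧ F₂.Reachable a b)) {u v : V} (huv : F₁.Adj u v) :
    (F₁ ⊔ F₂).IsBridge s(u, v) := by
  have hbr := isBridge_iff.1 (isAcyclic_iff_forall_adj_isBridge.1 h₁ huv)
  rw [isBridge_iff]
  have hd : (F₁ ⊔ F₂).deleteEdges {s(u, v)} ≤ F₂ ⊔ F₁.deleteEdges {s(u, v)} := by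
    intro x y hxy
    rw [deleteEdges_adj] at hxy
    rcases hxy.1 with h1 | h1
    · exact Or.inr (deleteEdges_adj.2 ⟨h1, hxy.2⟩)
    · exact Or.inl h1
  intro hr
  have hm := h.mono (deleteEdges_le {s(u, v)}) (le_refl F₂)
  have hbr' : ¬ (F₁.deleteEdges {s(u, v)}).Reachable u v := hbr
  have hadj : ∀ {x y}, (F₁.deleteEdges {s(u, v)}).Reachable x y → F₁.Reachable x y := fun h =>
    h.mono (deleteEdges_le _)
  rcases (hm.symm.reachable_sup_iff (x := u) (y := v) (fun z hz => h.vert _ _ _ huv hz)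
    (fun z hz => h.vert _ _ _ huv.symm hz)).1 (hr.mono hd) with h1 | ⟨h1, ⟨h2, h3⟩ | ⟨h2, h3⟩⟩
  · exact hbr' h1
  · exact hab ⟨(hadj h2).symm.trans (huv.reachable.trans (hadj h3).symm), h1⟩
  · exact hab ⟨(hadj h3).trans (huv.symm.reachable.trans (hadj h2)), h1⟩

/-- Two forests glued at `a` and `b` form a forest unless both connect `a` to `b`. -/
lemma MeetAt.isAcyclic_sup_iff (h : MeetAt F₁ F₂ a b) (hne : a ≠ b) :
    (F₁ ⊔ F₂).IsAcyclic ↔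
      F₁.IsAcyclic ∧ F₂.IsAcyclic ∧ ¬ (F₁.Reachable a b ∧ F₂.Reachable a b) := by
  constructor
  · intro hF
    refine ⟨hF.anti le_sup_left, hF.anti le_sup_right, ?_⟩
    rintro ⟨h1, h2⟩
    obtain ⟨p, hp⟩ := h1.exists_isPath
    obtain ⟨q, hq⟩ := h2.exists_isPath
    have hpq := (hF.subsingleton_path a b).elim ⟨p.mapLe le_sup_left, hp.mapLe le_sup_left⟩
      ⟨q.mapLe le_sup_right, hq.mapLe le_sup_right⟩
    have he : p.edges = q.edges := by
      have := congrArg (fun r : (F₁ ⊔ F₂).Path a b => r.1.edges) hpq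
      simpa using this
    cases p with
    | nil => exact hne rfl
    | @cons _ x _ hadj p =>
      have hmem : s(a, x) ∈ q.edges := by rw [← he]; simp
      exact h.edge _ _ hadj (q.edges_subset_edgeSet hmem)
  · rintro ⟨h1, h2, h3⟩
    rw [isAcyclic_iff_forall_adj_isBridge]
    rintro u v (huv | huv)
    · exact h.isBridge_of_left h1 h3 huv
    · rw [sup_comm]
      exact h.symm.isBridge_of_left h2 (fun h => h3 h.symm) huv

lemma weight_sup [Finite V] (h : MeetAt F₁ F₂ a b) (lam : ℝ) :
    weight lam (F₁ ⊔ F₂) = weight lam F₁ * weight lam F₂ := by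
  rw [weight, weight, weight, ← pow_add, edgeSet_sup, Set.ncard_union_eq]
  rw [Set.disjoint_left]
  intro e
  induction e with
  | _ x y => exact h.edge x y

end

section
variable [Fintype V] {G₁ G₂ : SimpleGraph V} {a b : V}

open scoped Classical in
/-- The forests of a glued graph are the unions of a forest of each part, not both of which connect
`a` to `b`. -/
lemma MeetAt.sum_forests_sup (h : MeetAt G₁ G₂ a b) (hne : a ≠ b) (f : SimpleGraph V → ℝ) :
    ∑ F ∈ forests (G₁ ⊔ G₂), f F = ∑ F₁ ∈ forests G₁, ∑ F₂ ∈ forests G₂,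
      if F₁.Reachable a b ∧ F₂.Reachable a b then 0 else f (F₁ ⊔ F₂) := by
  have hinf : ∀ {F₁ F₂ : SimpleGraph V}, F₁ ≤ G₁ → F₂ ≤ G₂ →
      (F₁ ⊔ F₂) ⊓ G₁ = F₁ ∧ (F₁ ⊔ F₂) ⊓ G₂ = F₂ := by
    intro F₁ F₂ h1 h2
    constructor <;> ext x y <;> simp only [inf_adj, sup_adj]
    · exact ⟨fun k => k.1.resolve_right fun k' => h.edge _ _ k.2 (h2 k'),
        fun k => ⟨Or.inl k, h1 k⟩⟩
    · exact ⟨fun k => k.1.resolve_left fun k' => h.edge _ _ (h1 k') k.2,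
        fun k => ⟨Or.inr k, h2 k⟩⟩
  have hsup : ∀ {F : SimpleGraph V}, F ≤ G₁ ⊔ G₂ → (F ⊓ G₁) ⊔ (F ⊓ G₂) = F := fun hF => by
    rw [← inf_sup_left, inf_eq_left.2 hF]
  simp only [← ite_not (p := _ ∧ _)]
  rw [← sum_product', ← sum_filter]
  refine sum_bij' (fun F _ => (F ⊓ G₁, F ⊓ G₂)) (fun p _ => p.1 ⊔ p.2) ?_ ?_ ?_ ?_ ?_
  · intro F hF
    rw [mem_forests] at hF
    have := (h.mono (inf_le_right : F ⊓ G₁ ≤ G₁) (inf_le_right : F ⊓ G₂ ≤ G₂)).isAcyclic_sup_iff hne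
    rw [hsup hF.1] at this
    obtain ⟨k1, k2, k3⟩ := this.1 hF.2
    simp only [mem_filter, mem_product, mem_forests]
    exact ⟨⟨⟨inf_le_right, k1⟩, inf_le_right, k2⟩, k3⟩
  · rintro ⟨F₁, F₂⟩ hF
    simp only [mem_filter, mem_product, mem_forests] at hF
    obtain ⟨⟨⟨k1, k2⟩, k3, k4⟩, k5⟩ := hF
    exact mem_forests.2 ⟨sup_le_sup k1 k3, ((h.mono k1 k3).isAcyclic_sup_iff hne).2 ⟨k2, k4, k5⟩⟩
  · intro F hF
    exact hsup (mem_forests.1 hF).1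
  · rintro ⟨F₁, F₂⟩ hF
    simp only [mem_filter, mem_product, mem_forests] at hF
    exact Prod.ext (hinf hF.1.1.1 hF.1.2.1).1 (hinf hF.1.1.1 hF.1.2.1).2
  · intro F hF
    simp only [hsup (mem_forests.1 hF).1]

open scoped Classical in
/-- The total weight of the forests in the event `A`. -/
noncomputable def mass (G : SimpleGraph V) (lam : ℝ) (A : SimpleGraph V → Prop) : ℝ :=
  ∑ F ∈ (forests G).filter A, weight lam F

lemma mass_congr {G : SimpleGraph V} {lam : ℝ} {A B : SimpleGraph V → Prop}
    (h : ∀ F ∈ forests G, A F ↔ B F) : mass G lam A = mass G lam B := by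
  classical
  rw [mass, mass, filter_congr h]

lemma mass_eq_zero {G : SimpleGraph V} {lam : ℝ} {A : SimpleGraph V → Prop}
    (h : ∀ F ∈ forests G, ¬ A F) : mass G lam A = 0 := by
  classical
  rw [mass, filter_false_of_mem h, sum_empty]

lemma mass_or {G : SimpleGraph V} {lam : ℝ} {A B : SimpleGraph V → Prop}
    (h : ∀ F ∈ forests G, A F → ¬ B F) :
    mass G lam (fun F => A F ∨ B F) = mass G lam A + mass G lam B := by
  classical
  simp only [mass, sum_filter]
  rw [← sum_add_distrib]
  refine sum_congr rfl fun F hF => ?_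
  by_cases k : A F
  · simp [k, h F hF k]
  · simp [k]

/-- Decomposition of a mass according to whether the first part of the forest connects the two
gluing vertices. The events `A'` and `A''` are what `A` requires of the second part in the two
cases. -/
lemma MeetAt.mass_sup (h : MeetAt G₁ G₂ a b) (hne : a ≠ b) {lam : ℝ}
    {A A' A'' : SimpleGraph V → Prop}
    (h0 : ∀ F₁ ∈ forests G₁, ∀ F₂ ∈ forests G₂, ¬ F₁.Reachable a b → (A (F₁ ⊔ F₂) ↔ A' F₂))
    (h1 : ∀ F₁ ∈ forests G₁, ∀ F₂ ∈ forests G₂, F₁.Reachable a b →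
      (¬ F₂.Reachable a b ∧ A (F₁ ⊔ F₂) ↔ A'' F₂)) :
    mass (G₁ ⊔ G₂) lam A = mass G₁ lam (fun F => ¬ F.Reachable a b) * mass G₂ lam A' +
      mass G₁ lam (fun F => F.Reachable a b) * mass G₂ lam A'' := by
  classical
  simp only [mass, sum_filter]
  rw [h.sum_forests_sup hne, sum_mul_sum, sum_mul_sum, ← sum_add_distrib]
  refine sum_congr rfl fun F₁ hF₁ => ?_
  rw [← sum_add_distrib]
  refine sum_congr rfl fun F₂ hF₂ => ?_
  rw [weight_sup (h.mono (mem_forests.1 hF₁).1 (mem_forests.1 hF₂).1)]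
  by_cases k : F₁.Reachable a b
  · simp only [k, true_and, not_true_eq_false, if_false, if_true, zero_mul, zero_add,
      ← h1 F₁ hF₁ F₂ hF₂ k]
    by_cases k2 : F₂.Reachable a b <;> simp [k2]
  · simp only [k, false_and, not_false_eq_true, if_false, if_true, zero_mul, add_zero,
      ← h0 F₁ hF₁ F₂ hF₂ k]
    simp

end
end

/-! ### Equality when no component touches all three vertices -/

section

open Filter

variable {V : Type*} [Fintype V]

/-- The event that `a`, `b`, `c` are in one component. -/
def Together (a b c : V) (F : SimpleGraph V) : Prop :=
  F.Reachable a b ∧ F.Reachable a c ∧ F.Reachable b c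

/-- The event that `a` and `b` are in one component, and `c` is in another. -/
def PairSplit (a b c : V) (F : SimpleGraph V) : Prop :=
  F.Reachable a b ∧ ¬ F.Reachable a c ∧ ¬ F.Reachable b c

/-- The event that `a`, `b`, `c` are in three different components. -/
def Separate (a b c : V) (F : SimpleGraph V) : Prop :=
  ¬ F.Reachable a b ∧ ¬ F.Reachable a c ∧ ¬ F.Reachable b c

/-- The gap of the inequality, for the unnormalized measure. -/
noncomputable def massGap (G : SimpleGraph V) (lam : ℝ) (a b c : V) : ℝ :=
  mass G lam (Separate a b c) * mass G lam (Together a b c) -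
    e2 (mass G lam (PairSplit b c a)) (mass G lam (PairSplit a b c)) (mass G lam (PairSplit a c b))

lemma prob_nonneg (G : SimpleGraph V) {lam : ℝ} (h : 0 ≤ lam) (A : SimpleGraph V → Prop) :
    0 ≤ prob G lam A :=
  div_nonneg (sum_nonneg fun _ _ => pow_nonneg h _) (sum_nonneg fun _ _ => pow_nonneg h _)

lemma gap_eq_massGap_div (G : SimpleGraph V) (lam : ℝ) (a b c : V) :
    gap G a b c lam = massGap G lam a b c / partitionFunction G lam ^ 2 := by
  have h : gap G a b c lam = mass G lam (Separate a b c) / partitionFunction G lam *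
      (mass G lam (Together a b c) / partitionFunction G lam) -
      e2 (mass G lam (PairSplit b c a) / partitionFunction G lam)
        (mass G lam (PairSplit a b c) / partitionFunction G lam)
        (mass G lam (PairSplit a c b) / partitionFunction G lam) := rfl
  rw [h, massGap, e2, e2]
  ring

lemma massGap_rotate (G : SimpleGraph V) (lam : ℝ) (a b c : V) :
    massGap G lam b c a = massGap G lam a b c := by
  have hs : ∀ (F : SimpleGraph V) (x y : V), F.Reachable x y ↔ F.Reachable y x :=
    fun F x y => ⟨Reachable.symm, Reachable.symm⟩
  have h1 : mass G lam (Separate b c a) = mass G lam (Separate a b c) := mass_congr fun F _ => by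
    simp only [Separate, hs F b a, hs F c a]; tauto
  have h2 : mass G lam (Together b c a) = mass G lam (Together a b c) := mass_congr fun F _ => by
    simp only [Together, hs F b a, hs F c a]; tauto
  have h3 : mass G lam (PairSplit c a b) = mass G lam (PairSplit a c b) :=
    mass_congr fun F _ => by simp only [PairSplit, hs F c a]; tauto
  have h4 : mass G lam (PairSplit b a c) = mass G lam (PairSplit a b c) :=
    mass_congr fun F _ => by simp only [PairSplit, hs F b a]; tauto
  rw [massGap, massGap, h1, h2, h3, h4, e2, e2]
  ring

/-- Gluing at `a` and `b` a graph that avoids `c` multiplies the gap by a square. -/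
lemma massGap_sup {G₁ G₂ : SimpleGraph V} {a b c : V} (h : MeetAt G₁ G₂ a b) (hab : a ≠ b)
    (hc : ∀ z, ¬ G₁.Adj c z) (lam : ℝ) :
    massGap (G₁ ⊔ G₂) lam a b c =
      mass G₁ lam (fun F => ¬ F.Reachable a b) ^ 2 * massGap G₂ lam a b c := by
  -- reachability in a glued forest between two of the three vertices
  have key : ∀ F₁ ∈ forests G₁, ∀ F₂ ∈ forests G₂, ∀ x y, (x = a ∨ x = b ∨ x = c) →
      (y = a ∨ y = b ∨ y = c) → ((F₁ ⊔ F₂).Reachable x y ↔ F₂.Reachable x y ∨ (F₁.Reachable a b ∧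
      ((F₂.Reachable x a ∧ F₂.Reachable b y) ∨ (F₂.Reachable x b ∧ F₂.Reachable a y)))) := by
    intro F₁ h1 F₂ h2 x y hx hy
    have hin : ∀ w, (w = a ∨ w = b ∨ w = c) → ∀ z, F₁.Adj w z → w = a ∨ w = b := by
      rintro w (rfl | rfl | rfl) z hz
      · exact Or.inl rfl
      · exact Or.inr rfl
      · exact absurd ((mem_forests.1 h1).1 hz) (hc z)
    exact (h.mono (mem_forests.1 h1).1 (mem_forests.1 h2).1).reachable_sup_iff (hin x hx) (hin y hy)
  have hs : ∀ (F : SimpleGraph V) (x y : V), F.Reachable x y ↔ F.Reachable y x :=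
    fun F x y => ⟨Reachable.symm, Reachable.symm⟩
  have kab := fun F₁ h1 F₂ h2 => key F₁ h1 F₂ h2 a b (by simp) (by simp)
  have kac := fun F₁ h1 F₂ h2 => key F₁ h1 F₂ h2 a c (by simp) (by simp)
  have kbc := fun F₁ h1 F₂ h2 => key F₁ h1 F₂ h2 b c (by simp) (by simp)
  have r : ∀ (F : SimpleGraph V) (x : V), F.Reachable x x := fun F x => Reachable.refl x
  have hsep : mass (G₁ ⊔ G₂) lam (Separate a b c) =
      mass G₁ lam (fun F => ¬ F.Reachable a b) * mass G₂ lam (Separate a b c) := by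
    rw [h.mass_sup hab (A := Separate a b c) (A' := Separate a b c) (A'' := fun _ => False),
      mass_eq_zero (A := fun _ => False) (by simp), mul_zero, add_zero]
    · intro F₁ h1 F₂ h2 k
      simp only [Separate, kab F₁ h1 F₂ h2, kac F₁ h1 F₂ h2, kbc F₁ h1 F₂ h2, k, false_and,
        or_false]
    · intro F₁ h1 F₂ h2 k
      simp [Separate, kab F₁ h1 F₂ h2, k]
  have hpab : mass (G₁ ⊔ G₂) lam (PairSplit a b c) =
      mass G₁ lam (fun F => ¬ F.Reachable a b) * mass G₂ lam (PairSplit a b c) +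
      mass G₁ lam (fun F => F.Reachable a b) * mass G₂ lam (Separate a b c) := by
    refine h.mass_sup hab ?_ ?_
    · intro F₁ h1 F₂ h2 k
      simp only [PairSplit, kab F₁ h1 F₂ h2, kac F₁ h1 F₂ h2, kbc F₁ h1 F₂ h2, k, false_and,
        or_false]
    · intro F₁ h1 F₂ h2 k
      simp only [PairSplit, Separate, kab F₁ h1 F₂ h2, kac F₁ h1 F₂ h2, kbc F₁ h1 F₂ h2, k, r,
        true_and, and_true]
      tauto
  have hpac : mass (G₁ ⊔ G₂) lam (PairSplit a c b) =
      mass G₁ lam (fun F => ¬ F.Reachable a b) * mass G₂ lam (PairSplit a c b) := by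
    rw [h.mass_sup hab (A := PairSplit a c b) (A' := PairSplit a c b) (A'' := fun _ => False),
      mass_eq_zero (A := fun _ => False) (by simp), mul_zero, add_zero]
    · intro F₁ h1 F₂ h2 k
      simp only [PairSplit, hs _ c b, kab F₁ h1 F₂ h2, kac F₁ h1 F₂ h2, kbc F₁ h1 F₂ h2, k,
        false_and, or_false]
    · intro F₁ h1 F₂ h2 k
      simp [PairSplit, kab F₁ h1 F₂ h2, k]
  have hpbc : mass (G₁ ⊔ G₂) lam (PairSplit b c a) =
      mass G₁ lam (fun F => ¬ F.Reachable a b) * mass G₂ lam (PairSplit b c a) := by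
    rw [h.mass_sup hab (A := PairSplit b c a) (A' := PairSplit b c a) (A'' := fun _ => False),
      mass_eq_zero (A := fun _ => False) (by simp), mul_zero, add_zero]
    · intro F₁ h1 F₂ h2 k
      simp only [PairSplit, hs _ c a, hs _ b a, kab F₁ h1 F₂ h2, kac F₁ h1 F₂ h2,
        kbc F₁ h1 F₂ h2, k, false_and, or_false]
    · intro F₁ h1 F₂ h2 k
      simp [PairSplit, hs _ b a, kab F₁ h1 F₂ h2, k]
  have htog : mass (G₁ ⊔ G₂) lam (Together a b c) =
      mass G₁ lam (fun F => ¬ F.Reachable a b) * mass G₂ lam (Together a b c) +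
      mass G₁ lam (fun F => F.Reachable a b) *
        (mass G₂ lam (PairSplit a c b) + mass G₂ lam (PairSplit b c a)) := by
    rw [← mass_or (A := PairSplit a c b) (B := PairSplit b c a)
      fun F _ h1 h2 => h2.2.2 h1.1.symm]
    refine h.mass_sup hab ?_ ?_
    · intro F₁ h1 F₂ h2 k
      simp only [Together, kab F₁ h1 F₂ h2, kac F₁ h1 F₂ h2, kbc F₁ h1 F₂ h2, k, false_and,
        or_false]
    · intro F₁ h1 F₂ h2 k
      simp only [Together, PairSplit, hs _ c a, hs _ c b, hs _ b a, kab F₁ h1 F₂ h2,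
        kac F₁ h1 F₂ h2, kbc F₁ h1 F₂ h2, k, r, true_and, and_true]
      by_cases k1 : F₂.Reachable a b <;> by_cases k2 : F₂.Reachable a c <;>
        by_cases k3 : F₂.Reachable b c <;> simp only [k1, k2, k3] <;>
          first | exact absurd (k2.trans k3.symm) k1 | simp
  rw [massGap, massGap, hsep, hpab, hpac, hpbc, htog, e2, e2]
  ring

/-- An isolated vertex `b` is never together with `a` or `c`, so each product in the gap vanishes.
-/
lemma massGap_eq_zero_of_isolated {G : SimpleGraph V} {a b c : V} (hab : a ≠ b) (hbc : b ≠ c)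
    (hb : ∀ z, ¬ G.Adj z b) (lam : ℝ) : massGap G lam a b c = 0 := by
  have hr : ∀ F ∈ forests G, ∀ x, x ≠ b → ¬ F.Reachable x b := by
    intro F hF x hx h
    rcases eq_or_adj_of_reachable h with rfl | ⟨z, hz⟩
    · exact hx rfl
    · exact hb z ((mem_forests.1 hF).1 hz.symm)
  have h1 : mass G lam (Together a b c) = 0 :=
    mass_eq_zero fun F hF h => hr F hF a hab h.1
  have h2 : mass G lam (PairSplit a b c) = 0 :=
    mass_eq_zero fun F hF h => hr F hF a hab h.1
  have h3 : mass G lam (PairSplit b c a) = 0 :=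
    mass_eq_zero fun F hF h => hr F hF c hbc.symm h.1.symm
  rw [massGap, h1, h2, h3, e2]
  ring

/-- The part of the graph `G` inside the vertex set `S`. -/
def inside (G : SimpleGraph V) (S : Set V) : SimpleGraph V where
  Adj x y := G.Adj x y ∧ x ∈ S ∧ y ∈ S
  symm := ⟨fun _ _ h => ⟨h.1.symm, h.2.2, h.2.1⟩⟩
  loopless := ⟨fun _ h => G.loopless.irrefl _ h.1⟩

/-- If no component of the graph without `a`, `b`, `c` touches all three, then the graph is glued
together, in a triangle, from three parts each of which avoids one of `a`, `b`, `c`. -/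
theorem massGap_eq_zero_of_not_touches [DecidableEq V] {G : SimpleGraph V} {a b c : V}
    (hab : a ≠ b) (hac : a ≠ c) (hbc : b ≠ c)
    (h : ∀ u, u ∉ ({a, b, c} : Finset V) → ¬ (Touches G {a, b, c} u a ∧
      Touches G {a, b, c} u b ∧ Touches G {a, b, c} u c)) (lam : ℝ) :
    massGap G lam a b c = 0 := by
  set T : Finset V := {a, b, c} with hT
  have mT : ∀ x, x ∈ T ↔ x = a ∨ x = b ∨ x = c := by simp [hT]
  -- A component that touches `c` but not `a` goes to the part that avoids `a`, one that touches
  -- both `a` and `c` to the part that avoids `b`, and one that does not touch `c` to the part that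
  -- avoids `c`.
  obtain ⟨V₁, m1⟩ : ∃ S : Set V, ∀ x, x ∈ S ↔ (x ∉ T ∧ ¬ Touches G T x c) ∨ x = a ∨ x = b :=
    ⟨{x | _}, fun _ => Iff.rfl⟩
  obtain ⟨V₂, m2⟩ : ∃ S : Set V, ∀ x, x ∈ S ↔
      (x ∉ T ∧ Touches G T x c ∧ ¬ Touches G T x a) ∨ x = b ∨ x = c :=
    ⟨{x | _}, fun _ => Iff.rfl⟩
  obtain ⟨V₃, m3⟩ : ∃ S : Set V, ∀ x, x ∈ S ↔
      (x ∉ T ∧ Touches G T x c ∧ Touches G T x a) ∨ x = a ∨ x = c :=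
    ⟨{x | _}, fun _ => Iff.rfl⟩
  have ma := (mT a).2 (by simp)
  have mb := (mT b).2 (by simp)
  have mc := (mT c).2 (by simp)
  have i12 : ∀ x, x ∈ V₁ → x ∈ V₂ → x = b := by
    intro x
    rw [m1, m2]
    grind
  have i13 : ∀ x, x ∈ V₁ → x ∈ V₃ → x = a := by
    intro x
    rw [m1, m3]
    grind
  have i23 : ∀ x, x ∈ V₂ → x ∈ V₃ → x = c := by
    intro x
    rw [m2, m3]
    grind
  have hG : inside G V₁ ⊔ (inside G V₂ ⊔ inside G V₃) = G := by
    -- an edge at a vertex outside of `T`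
    have hout : ∀ x y, G.Adj x y → x ∉ T →
        (x ∈ V₁ ∧ y ∈ V₁) ∨ (x ∈ V₂ ∧ y ∈ V₂) ∨ (x ∈ V₃ ∧ y ∈ V₃) := by
      intro x y hxy hx
      have hself : y ∈ T → Touches G T x y := fun _ => ⟨x, Reachable.refl _, hxy⟩
      have hx3 := h x hx
      rw [m1, m1, m2, m2, m3, m3]
      by_cases hy : y ∈ T
      · have hty := hself hy
        rcases (mT y).1 hy with e | e | e <;> rw [e] at hty <;>
          by_cases h1 : Touches G T x c <;> by_cases h2 : Touches G T x a <;>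
            first
            | exact absurd hty h1
            | exact absurd hty h2
            | exact (hx3 ⟨h2, hty, h1⟩).elim
            | simp [hx, h1, h2, e]
      · rw [← touches_adj hx hy hxy, ← touches_adj hx hy hxy]
        by_cases h1 : Touches G T x c <;> by_cases h2 : Touches G T x a <;> simp [hx, hy, h1, h2]
    ext x y
    constructor
    · rintro (h | h | h) <;> exact h.1
    · intro hxy
      have hcase : (x ∈ V₁ ∧ y ∈ V₁) ∨ (x ∈ V₂ ∧ y ∈ V₂) ∨ (x ∈ V₃ ∧ y ∈ V₃) := by
        by_cases hx : x ∈ T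
        · by_cases hy : y ∈ T
          · have hne := hxy.ne
            rw [m1, m1, m2, m2, m3, m3]
            rcases (mT x).1 hx with h | h | h <;> rcases (mT y).1 hy with h' | h' | h' <;>
              first | exact absurd (h.trans h'.symm) hne | simp [h, h']
          · have := hout y x hxy.symm hy
            tauto
        · exact hout x y hxy hx
      rcases hcase with h | h | h
      · exact Or.inl ⟨hxy, h⟩
      · exact Or.inr (Or.inl ⟨hxy, h⟩)
      · exact Or.inr (Or.inr ⟨hxy, h⟩)
  have hmeet₁ : MeetAt (inside G V₁) (inside G V₂ ⊔ inside G V₃) a b := by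
    constructor
    · rintro x y z ⟨-, h1, -⟩ (⟨-, h2, -⟩ | ⟨-, h2, -⟩)
      · exact Or.inr (i12 x h1 h2)
      · exact Or.inl (i13 x h1 h2)
    · rintro x y ⟨h0, h1, h2⟩ (⟨-, h3, h4⟩ | ⟨-, h3, h4⟩)
      · exact h0.ne ((i12 x h1 h3).trans (i12 y h2 h4).symm)
      · exact h0.ne ((i13 x h1 h3).trans (i13 y h2 h4).symm)
  have hmeet₂ : MeetAt (inside G V₂) (inside G V₃) b c := by
    constructor
    · rintro x y z ⟨-, h1, -⟩ ⟨-, h2, -⟩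
      exact Or.inr (i23 x h1 h2)
    · rintro x y ⟨h0, h1, h2⟩ ⟨-, h3, h4⟩
      exact h0.ne ((i23 x h1 h3).trans (i23 y h2 h4).symm)
  have hc : c ∉ V₁ := by simp [m1, mc, hac.symm, hbc.symm]
  have ha : a ∉ V₂ := by simp [m2, ma, hab, hac]
  have hb : b ∉ V₃ := by simp [m3, mb, hab.symm, hbc]
  -- Strip off the first part at `a` and `b`, then the second at `b` and `c`.
  rw [← hG, massGap_sup hmeet₁ hab (fun z hz => hc hz.2.1), ← massGap_rotate,
    massGap_sup hmeet₂ hbc (fun z hz => ha hz.2.1), massGap_rotate,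
    massGap_eq_zero_of_isolated (G := inside G V₃) hab hbc (fun z hz => hb hz.2.2), mul_zero,
    mul_zero]

/-- If two of the vertices coincide, then each product in the gap has a factor whose event is
impossible. -/
lemma massGap_eq_zero_of_eq {G : SimpleGraph V} {a b c : V} (h : a = b ∨ a = c ∨ b = c)
    (lam : ℝ) : massGap G lam a b c = 0 := by
  have key : ∀ x y : V, massGap G lam x x y = 0 := by
    intro x y
    have h1 : mass G lam (Separate x x y) = 0 :=
      mass_eq_zero fun F _ h => h.1 (Reachable.refl _)
    have h2 : mass G lam (PairSplit x y x) = 0 :=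
      mass_eq_zero fun F _ h => h.2.1 (Reachable.refl _)
    rw [massGap, h1, h2, e2]
    ring
  rcases h with rfl | rfl | rfl
  · exact key _ _
  · rw [← massGap_rotate, ← massGap_rotate, key]
  · rw [← massGap_rotate, key]

/-- The gap is eventually nonnegative, and negligible against the right-hand side. -/
theorem gap_eventually_nonneg_and_isLittleO (G : SimpleGraph V) (a b c : V) :
    (∀ᶠ lam in atTop, 0 ≤ gap G a b c lam) ∧ gap G a b c =o[atTop]
      fun lam => probSeparate G lam a b c * probTogether G lam a b c := by
  classical
  have hzero : (∀ lam, massGap G lam a b c = 0) → (∀ᶠ lam in atTop, 0 ≤ gap G a b c lam) ∧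
      gap G a b c =o[atTop] fun lam => probSeparate G lam a b c * probTogether G lam a b c := by
    intro h
    have h0 : gap G a b c = fun _ => 0 := by
      funext lam
      rw [gap_eq_massGap_div, h, zero_div]
    rw [h0]
    exact ⟨Eventually.of_forall fun _ => le_rfl, Asymptotics.isLittleO_zero _ _⟩
  by_cases heq : a = b ∨ a = c ∨ b = c
  · exact hzero fun lam => massGap_eq_zero_of_eq heq lam
  push Not at heq
  obtain ⟨hab, hac, hbc⟩ := heq
  by_cases hex : ∃ u, u ∉ ({a, b, c} : Finset V) ∧ Touches G {a, b, c} u a ∧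
      Touches G {a, b, c} u b ∧ Touches G {a, b, c} u c
  · obtain ⟨u, hu, ha, hb, hc⟩ := hex
    obtain ⟨R, hR, hRT⟩ := exists_isRootSystem hab hac hbc (ha.reachable.symm.trans hb.reachable)
      (ha.reachable.symm.trans hc.reachable)
    exact gap_of_touches hR (hRT u hu ha.reachable.symm) ha hb hc
  · exact hzero fun lam => massGap_eq_zero_of_not_touches hab hac hbc
      (fun u hu h => hex ⟨u, hu, h⟩) lam

end

end ArborealGas

theorem mainTheorem11 {V : Type*} [Fintype V] (G : SimpleGraph V) (a b c : V) :
    -- the inequality for all large enough values of the parameter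
    (∀ᶠ lam : ℝ in Filter.atTop,
      (ArborealGas.probPairSplit G lam b c a + ArborealGas.probPairSplit G lam a c b) *
          (ArborealGas.probPairSplit G lam a b c + ArborealGas.probPairSplit G lam a c b) ≤
        ArborealGas.probSeparate G lam a b c * ArborealGas.probTogether G lam a b c +
          ArborealGas.probPairSplit G lam a c b ^ 2) ∧
    -- the form with the elementary symmetric polynomial
    (∀ᶠ lam : ℝ in Filter.atTop,
      ArborealGas.e2 (ArborealGas.probPairSplit G lam b c a)
          (ArborealGas.probPairSplit G lam a b c) (ArborealGas.probPairSplit G lam a c b) ≤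
        ArborealGas.probSeparate G lam a b c * ArborealGas.probTogether G lam a b c) ∧
    -- the two forms are equivalent at every value of the parameter
    (∀ lam : ℝ, 0 < lam →
      ((ArborealGas.probPairSplit G lam b c a + ArborealGas.probPairSplit G lam a c b) *
          (ArborealGas.probPairSplit G lam a b c + ArborealGas.probPairSplit G lam a c b) ≤
        ArborealGas.probSeparate G lam a b c * ArborealGas.probTogether G lam a b c +
          ArborealGas.probPairSplit G lam a c b ^ 2 ↔
      ArborealGas.e2 (ArborealGas.probPairSplit G lam b c a)
          (ArborealGas.probPairSplit G lam a b c) (ArborealGas.probPairSplit G lam a c b) ≤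
        ArborealGas.probSeparate G lam a b c * ArborealGas.probTogether G lam a b c)) ∧
    -- equality to leading order in the limit, for both forms
    Asymptotics.IsEquivalent Filter.atTop
      (fun lam : ℝ =>
        (ArborealGas.probPairSplit G lam b c a + ArborealGas.probPairSplit G lam a c b) *
          (ArborealGas.probPairSplit G lam a b c + ArborealGas.probPairSplit G lam a c b))
      (fun lam : ℝ =>
        ArborealGas.probSeparate G lam a b c * ArborealGas.probTogether G lam a b c +
          ArborealGas.probPairSplit G lam a c b ^ 2) ∧
    Asymptotics.IsEquivalent Filter.atTop
      (fun lam : ℝ =>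
        ArborealGas.e2 (ArborealGas.probPairSplit G lam b c a)
          (ArborealGas.probPairSplit G lam a b c) (ArborealGas.probPairSplit G lam a c b))
      (fun lam : ℝ =>
        ArborealGas.probSeparate G lam a b c * ArborealGas.probTogether G lam a b c) := by
  obtain ⟨hpos, hlit⟩ := ArborealGas.gap_eventually_nonneg_and_isLittleO G a b c
  refine ⟨?_, ?_, ?_, ?_, ?_⟩
  · filter_upwards [hpos] with lam h
    rw [ArborealGas.gap, ArborealGas.e2] at h
    linarith
  · filter_upwards [hpos] with lam h
    rw [ArborealGas.gap] at h
    linarith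
  · intro lam _
    rw [ArborealGas.e2]
    constructor <;> intro h <;> linarith
  · -- the right-hand side exceeds the one of the second form by a square
    have h : (fun lam =>
        ArborealGas.probSeparate G lam a b c * ArborealGas.probTogether G lam a b c) =O[Filter.atTop]
        fun lam => ArborealGas.probSeparate G lam a b c *
          ArborealGas.probTogether G lam a b c + ArborealGas.probPairSplit G lam a c b ^ 2 := by
      refine Asymptotics.IsBigO.of_bound 1 ?_
      filter_upwards [Filter.eventually_gt_atTop 0] with lam hl
      have h0 : 0 ≤ ArborealGas.probSeparate G lam a b c * ArborealGas.probTogether G lam a b c :=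
        mul_nonneg (ArborealGas.prob_nonneg G hl.le _) (ArborealGas.prob_nonneg G hl.le _)
      have h1 := sq_nonneg (ArborealGas.probPairSplit G lam a c b)
      rw [one_mul, Real.norm_of_nonneg h0, Real.norm_of_nonneg (add_nonneg h0 h1)]
      linarith
    refine ((hlit.neg_left).trans_isBigO h).congr_left fun lam => ?_
    simp only [ArborealGas.gap, ArborealGas.e2, Pi.sub_apply]
    ring
  · refine hlit.neg_left.congr_left fun lam => ?_
    simp only [ArborealGas.gap, Pi.sub_apply]
    ring
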